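/- Let $\Omega\subset\mathbb{R}^2$ be a bounded open set, $\mathbb{S}^1=\mathbb{R}/2\pi\mathbb{Z}$, $\underline\theta=(\cos\theta,\sin\theta)$ and $x^\perp=(x_2,-x_1)$. Let $f:\mathbb{R}\to[0,+\infty]$ be convex and lower semicontinuous, with $f(t)\ge\gamma\sqrt{1+t^2}$ for all $t$, for some $\gamma>0$. Let $f^*$ be its convex conjugate and $f^\infty(t)=\lim_{s\to+\infty}f(st)/s$ its recession function. For $p=(p^x,p^\theta)\in\mathbb{R}^2\times\mathbb{R}$ put $$h(\theta,p)=\begin{cases}|p^x|f(p^\theta/|p^x|)&\text{if }p^x\in\mathbb{R}_+\underline\theta,\ p^x\ne0,\\ f^\infty(p^\theta)&\text{if }p^x=0,\\ +\infty&\text{otherwise.}\end{cases}$$ For $u\in L^1(\Omega)$ define $$F(u)=\inf\Big\{\int_{\Omega\times\mathbb{S}^1}h\Big(\theta,\frac{\sigma}{|\sigma|}\Big)d|\sigma| : \operatorname{div}\sigma=0,\ \int_{\mathbb{S}^1}\sigma^x\,d\theta=Du^\perp\Big\},$$ the infimum being over bounded $\mathbb{R}^3$-valued Radon measures $\sigma$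 on $\Omega\times\mathbb{S}^1$. Here $\operatorname{div}\sigma=0$ means $\int\nabla\varphi\cdot d\sigma=0$ for all $\varphi\in C^1_c(\Omega\times\mathbb{S}^1)$, and the last condition means $\int\varphi^\perp\cdot d\sigma^x=-\int_\Omega u\operatorname{div}\varphi\,dx$ for all $\varphi\in C_c^1(\Omega;\mathbb{R}^2)$. Define the relaxation obtained by lifting position, tangent and curvature as independent variables by $$R^{**}(u)=\inf_\mu\int_{\Omega\times\mathbb{S}^1\times\mathbb{R}}f(\kappa)\,d\mu(x,\theta,\kappa),$$ the infimum being over finite nonnegative Borel measures $\mu$ on $\Omega\times\mathbb{S}^1\times\mathbb{R}$ with $\int|\kappa|\,d\mu<\infty$ such that $$\int\big(\underline\theta\cdot\nabla_x\varphi(x,\theta)+\kappa\,\partial_\theta\varphi(x,\theta)\big)d\mu=0\quad\forall\varphi\in C_c^1(\Omega\times\mathbb{S}^1),$$ $$\int\varphi(x)^\perp\cdot\underline\theta\,d\mu=-\int_\Omega u\operatorname{div}\varphi\,dx\quad\forall\varphi\in C^1_c(\Omega;\mathbb{R}^2).$$ For the Elastica integrand $f(\kappa)=1+\alpha^2\kappa^2$,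 $\alpha>0$, this is the relaxation $R^{**}_{\mathrm{el}}$ of the Elastica energy of Bredies, Pock and Wirth. Then: (1) For the Elastica integrand, $F(u)=R^{**}_{\mathrm{el}}(u)$ for all $u\in L^1(\Omega)$, and if $u\in BV(\Omega)$ both are equal to $$\sup\Big\{\int_\Omega\psi\cdot Du^\perp : \psi\in C_c^0(\Omega;\mathbb{R}^2),\ \exists\,\varphi\in C_c^1(\Omega\times\mathbb{S}^1),\ \underline\theta\cdot(\nabla_x\varphi+\psi)+f^*(\partial_\theta\varphi)\le0 \text{ in }\Omega\times\mathbb{S}^1\Big\}.\qquad(*)$$ (2) For every $f$ as above and $u\in BV(\Omega)$, $F(u)$ equals the supremum in $(*)$, and the supremum has the same value if $\varphi$ ranges instead over the functions in $C^1(\Omega\times\mathbb{S}^1)$ with $\nabla\varphi\in C^0_c(\Omega\times\mathbb{S}^1)$. If moreover $f^\infty(t)=+\infty$ for all $t\ne0$, then $F(u)=R^{**}(u)$ for all $u\in L^1(\Omega)$. -/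

import Mathlib

open MeasureTheory Set Filter Topology
open scoped ENNReal NNReal InnerProductSpace

noncomputable section

namespace RotoTV

/-- The plane with its Euclidean norm. -/
abbrev E2 : Type := EuclideanSpace ℝ (Fin 2)

/-- The space of vectors `p = (p^x, p^θ)`, with its Euclidean norm. -/
abbrev E3 : Type := EuclideanSpace ℝ (Fin 3)

/-- The circle of orientations, as angles modulo `2π`. -/
abbrev S1 : Type := AddCircle (2 * Real.pi)

/-- The unit vector `(cos θ, sin θ)`. -/
def dir (θ : S1) : E2 := !₂[Real.cos_periodic.lift θ, Real.sin_periodic.lift θ]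

/-- The rotation `x^⊥ = (x₂, -x₁)`. -/
def perp : E2 →L[ℝ] E2 :=
  LinearMap.toContinuousLinearMap
    { toFun := fun v => !₂[v 1, -v 0]
      map_add' := by
        intro v w; ext i; fin_cases i <;> simp [add_comm]
      map_smul' := by
        intro c v; ext i; fin_cases i <;> simp }

/-- The spatial part `p^x` of `p = (p^x, p^θ)`. -/
def spat (p : E3) : E2 := !₂[p 0, p 1]

/-- The vector `(a, t)` with spatial part `a` and angular part `t`. -/
def join (a : E2) (t : ℝ) : E3 := !₂[a 0, a 1, t]

/-- The divergence of a planar vector field. -/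
def planeDiv (φ : E2 → E2) (x : E2) : ℝ :=
  ∑ i : Fin 2, fderiv ℝ φ x (EuclideanSpace.single i 1) i

/-- The spatial gradient `∇_x φ` of a function on the plane times the circle. -/
def gradX (φ : E2 × S1 → ℝ) (z : E2 × S1) : E2 := gradient (fun y : E2 => φ (y, z.2)) z.1

/-- The angular derivative `∂_θ φ`. -/
def dTheta (φ : E2 × S1 → ℝ) (z : E2 × S1) : ℝ :=
  deriv (fun t : ℝ => φ (z.1, z.2 + (t : S1))) 0

/-- A function on the plane times the circle, read as a `2π`-periodic function of a real angle. -/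
def unroll (φ : E2 × S1 → ℝ) (q : E2 × ℝ) : ℝ := φ (q.1, (q.2 : S1))

/-- `φ ∈ C_c^1(Ω × S¹)`. -/
def IsTest (Ω : Set E2) (φ : E2 × S1 → ℝ) : Prop :=
  ContDiff ℝ 1 (unroll φ) ∧ HasCompactSupport φ ∧ tsupport φ ⊆ Ω ×ˢ univ

/-- `φ ∈ C^1(Ω × S¹)` with `∇φ ∈ C_c^0(Ω × S¹)`. -/
def IsTestGrad (Ω : Set E2) (φ : E2 × S1 → ℝ) : Prop :=
  ContDiffOn ℝ 1 (unroll φ) (Ω ×ˢ univ) ∧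
    ∃ C : Set E2, IsCompact C ∧ C ⊆ Ω ∧
      ∀ x ∈ Ω \ C, ∀ θ : S1, gradX φ (x, θ) = 0 ∧ dTheta φ (x, θ) = 0

/-- `φ ∈ C_c^1(Ω; ℝ²)`. -/
def IsPlaneTest (Ω : Set E2) (φ : E2 → E2) : Prop :=
  ContDiff ℝ 1 φ ∧ HasCompactSupport φ ∧ tsupport φ ⊆ Ω

/-- The integral `∫ φ · σ` of a vector field against a vector-valued measure. -/
def pair {X V : Type*} [MeasurableSpace X] [NormedAddCommGroup V] [InnerProductSpace ℝ V]
    (φ : X → V) (σ : VectorMeasure X V) : ℝ :=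
  σ.integral φ (innerSL ℝ)

/-! ### The integrand -/

/-- The recession function `f^∞(t) = lim_{s → ∞} f(s t) / s`. -/
def recession (f : ℝ → ℝ≥0∞) (t : ℝ) : ℝ≥0∞ :=
  limsup (fun s : ℝ => f (s * t) / ENNReal.ofReal s) atTop

/-- The convex conjugate `f^*`. -/
def conj (f : ℝ → ℝ≥0∞) (s : ℝ) : EReal :=
  ⨆ t : ℝ, ((s * t : ℝ) : EReal) - (f t : EReal)

open Classical in
/-- The integrand `h(θ, p)`: it is `|p^x| f(p^θ / |p^x|)` if `p^x ≠ 0` is a nonnegative multiple of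
`(cos θ, sin θ)`, it is `f^∞(p^θ)` if `p^x = 0`, and it is `+∞` otherwise. -/
def hfun (f : ℝ → ℝ≥0∞) (θ : S1) (p : E3) : ℝ≥0∞ :=
  if spat p = 0 then recession f (p 2)
  else if ∃ r : ℝ, 0 ≤ r ∧ spat p = r • dir θ then
    ENNReal.ofReal ‖spat p‖ * f (p 2 / ‖spat p‖)
  else ⊤

/-! ### The functional `F` -/

/-- The component `σ_i` of an `ℝ³`-valued measure. -/
def comp {X : Type*} [MeasurableSpace X] (σ : VectorMeasure X E3) (i : Fin 3) : SignedMeasure X :=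
  σ.mapRange (EuclideanSpace.proj (𝕜 := ℝ) i : E3 →L[ℝ] ℝ).toLinearMap.toAddMonoidHom
    (EuclideanSpace.proj (𝕜 := ℝ) i : E3 →L[ℝ] ℝ).continuous

/-- The density `σ / |σ|` of an `ℝ³`-valued measure with respect to its total variation. -/
def polar {X : Type*} [MeasurableSpace X] (σ : VectorMeasure X E3) (z : X) : E3 :=
  !₂[(comp σ 0).rnDeriv σ.variation z, (comp σ 1).rnDeriv σ.variation z,
    (comp σ 2).rnDeriv σ.variation z]

/-- The energy `∫_{Ω × S¹} h(θ, σ) = ∫ h(θ, σ / |σ|) d|σ|`. -/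
def energy (f : ℝ → ℝ≥0∞) {Ω : Set E2} (σ : VectorMeasure (Ω × S1) E3) : ℝ≥0∞ :=
  ∫⁻ z, hfun f z.2 (polar σ z) ∂σ.variation

/-- `div σ = 0` in `Ω × S¹`, in the sense of distributions. -/
def DivFree {Ω : Set E2} (σ : VectorMeasure (Ω × S1) E3) : Prop :=
  ∀ φ : E2 × S1 → ℝ, IsTest Ω φ →
    pair (fun z : Ω × S1 => join (gradX φ (z.1, z.2)) (dTheta φ (z.1, z.2))) σ = 0

/-- `∫_{S¹} σ^x dθ = Du^⊥`: for all `φ ∈ C_c^1(Ω; ℝ²)`, `∫ φ^⊥ · σ^x = -∫_Ω u div φ`. -/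
def Projects {Ω : Set E2} (u : E2 → ℝ) (σ : VectorMeasure (Ω × S1) E3) : Prop :=
  ∀ φ : E2 → E2, IsPlaneTest Ω φ →
    pair (fun z : Ω × S1 => join (perp (φ z.1)) 0) σ = -∫ x in Ω, u x * planeDiv φ x

/-- The functional `F(u)` on `Ω` with integrand `f`; the infimum is over the bounded
`ℝ³`-valued Radon measures on `Ω × S¹`. -/
def F (f : ℝ → ℝ≥0∞) (Ω : Set E2) (u : E2 → ℝ) : ℝ≥0∞ :=
  ⨅ (σ : VectorMeasure (Ω × S1) E3) (_ : DivFree σ) (_ : Projects u σ), energy f σ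

/-! ### The relaxation by lifting of position, tangent and curvature -/

/-- The finite nonnegative measure `μ` on `Ω × S¹ × ℝ`, whose points are triples (position, angle
of the tangent, curvature), is a lifting of the level lines of `u`: along `μ` the position moves
with velocity `(cos θ, sin θ)` and the angle with velocity `κ` with no source in `Ω × S¹`, and the
tangents add up to `Du^⊥`. -/
structure IsLifting {Ω : Set E2} (u : E2 → ℝ) (μ : Measure (Ω × S1 × ℝ)) : Prop where
  finite : IsFiniteMeasure μ
  integrable : Integrable (fun z : Ω × S1 × ℝ => z.2.2) μ
  consistent : ∀ φ : E2 × S1 → ℝ, IsTest Ω φ →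
    ∫ z : Ω × S1 × ℝ, (⟪gradX φ (z.1, z.2.1), dir z.2.1⟫_ℝ
      + z.2.2 * dTheta φ (z.1, z.2.1)) ∂μ = 0
  compatible : ∀ φ : E2 → E2, IsPlaneTest Ω φ →
    ∫ z : Ω × S1 × ℝ, ⟪perp (φ z.1), dir z.2.1⟫_ℝ ∂μ = -∫ x in Ω, u x * planeDiv φ x

/-- The lifted relaxation of the energy `∫ f(κ) d|Du|`, `κ` being the curvature of the level lines
of `u`: the least value of `∫ f(κ) dμ` among the liftings `μ` of `u`. -/
def liftedRelaxation (f : ℝ → ℝ≥0∞) (Ω : Set E2) (u : E2 → ℝ) : ℝ≥0∞ :=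
  ⨅ (μ : Measure (Ω × S1 × ℝ)) (_ : IsLifting u μ), ∫⁻ z, f z.2.2 ∂μ

/-- The integrand `1 + α² κ²` of Euler's Elastica. -/
def elastica (α : ℝ) (t : ℝ) : ℝ≥0∞ := ENNReal.ofReal (1 + α ^ 2 * t ^ 2)

/-- The relaxation `R**_el` of the Elastica energy. -/
def Rel (α : ℝ) (Ω : Set E2) (u : E2 → ℝ) : ℝ≥0∞ := liftedRelaxation (elastica α) Ω u

/-! ### The dual formula -/

/-- The finite `ℝ²`-valued Radon measure `Du` is the distributional derivative of `u` in `Ω`. -/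
def IsDerivMeasure (Ω : Set E2) (u : E2 → ℝ) (Du : VectorMeasure Ω E2) : Prop :=
  ∀ φ : E2 → E2, IsPlaneTest Ω φ →
    pair (fun x : Ω => φ x) Du = -∫ x in Ω, u x * planeDiv φ x

/-- The measure `Du^⊥`. -/
def perpMeasure {Ω : Set E2} (Du : VectorMeasure Ω E2) : VectorMeasure Ω E2 :=
  Du.mapRange perp.toLinearMap.toAddMonoidHom perp.continuous

/-- `ψ ∈ C_c^0(Ω; ℝ²)` and `(cos θ, sin θ) · (∇_x φ + ψ) + f^*(∂_θ φ) ≤ 0` in `Ω × S¹` for some `φ`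
in the class `A` of functions. -/
def DualFeasible (f : ℝ → ℝ≥0∞) (Ω : Set E2) (A : (E2 × S1 → ℝ) → Prop) (ψ : E2 → E2) : Prop :=
  Continuous ψ ∧ HasCompactSupport ψ ∧ tsupport ψ ⊆ Ω ∧
    ∃ φ : E2 × S1 → ℝ, A φ ∧ ∀ x ∈ Ω, ∀ θ : S1,
      ((⟪dir θ, gradX φ (x, θ) + ψ x⟫_ℝ : ℝ) : EReal) + conj f (dTheta φ (x, θ)) ≤ 0

/-- The supremum of `∫_Ω ψ · Du^⊥` over the feasible `ψ`. -/
def dualValue (f : ℝ → ℝ≥0∞) (Ω : Set E2) (A : (E2 × S1 → ℝ) → Prop)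
    (Du : VectorMeasure Ω E2) : EReal :=
  ⨆ (ψ : E2 → E2) (_ : DualFeasible f Ω A ψ),
    ((pair (fun x : Ω => ψ x) (perpMeasure Du) : ℝ) : EReal)

end RotoTV

end

/-! The integrand is a support function. For `p ≠ 0`, `h(θ, p)` is the supremum of the linear forms
`dualVec θ ((a, b), d)` at `p`, where `a + b t` runs over the affine minorants of `f` and `d` over
all reals. The slopes `b` produce the recession function, and the free multiplier `d` across `dir θ`
enforces the ray constraint. Countably many forms suffice (`exists_seq_hfun_le`), so the energy is a
supremum of integrals of bounded fields against `σ`, and it does not increase when a density is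
pushed forward (`energy_pushDensity_le`).

A lifting `μ` yields `σ` by pushing `(dir θ, κ) μ` forward to `Ω × S¹`, and `h(θ, (dir θ, κ)) = f
κ`; hence `F ≤ R**`. Conversely, if `f` is superlinear, finite energy forces `σ^x = r dir θ |σ|`
with `r > 0` almost everywhere, and `r |σ|` carried to the curvature `p^θ / r` is a lifting with the
same energy.

The dual constraint says that `(dir θ · (∇_x φ + ψ), ∂_θ φ)` is an affine minorant of `f`
(`add_conj_nonpos_iff`), so integrating against `σ` gives weak duality. In the larger class of `φ`,
the gradient differs from that of a test function by a rotated divergence-free field, which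
`Projects` annihilates.

For strong duality, the directions where `h` may be finite are, up to positive multiples, `arcVec θ
z` with `z ∈ [-1, 1]`. The problem becomes a linear program over nonnegative measures on `(Ω × S¹) ×
[-1, 1]`, with lower semicontinuous cost at least `γ / 2`. Hahn-Banach and Riesz-Markov solve it
(`exists_measure_of_forall_le`), and Jensen brings the solution back to `Ω × S¹`. The compact fibre
contains the vertical directions `z = ±1`, so linear growth of `f` is allowed. -/

noncomputable section

namespace RotoTV

/-! ### Polar decomposition and push-forward of vector measures -/

section VectorMeasures

variable {X T : Type*} [MeasurableSpace X] [MeasurableSpace T]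

/-- A vector measure with values in a Euclidean space has finite variation. -/
theorem isFiniteMeasure_variation {n : ℕ} (σ : VectorMeasure X (EuclideanSpace ℝ (Fin n))) :
    IsFiniteMeasure σ.variation := by
  let c : Fin n → SignedMeasure X := fun i =>
    σ.mapRange (EuclideanSpace.proj (𝕜 := ℝ) i :
      EuclideanSpace ℝ (Fin n) →L[ℝ] ℝ).toLinearMap.toAddMonoidHom
      (EuclideanSpace.proj (𝕜 := ℝ) i : EuclideanSpace ℝ (Fin n) →L[ℝ] ℝ).continuous
  have hc : ∀ i, IsFiniteMeasure (c i).variation := fun i => by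
    rw [← SignedMeasure.totalVariation_eq_variation]; infer_instance
  refine isFiniteMeasure_of_le (∑ i, (c i).variation)
    (VectorMeasure.variation_le_of_forall_enorm_le fun E _ => ?_)
  rw [Measure.coe_finsetSum, Finset.sum_apply]
  have h1 : σ E = ∑ i, (σ E i) • EuclideanSpace.single i (1 : ℝ) := by
    ext j
    simp [Finset.sum_apply, Pi.single_apply]
  calc ‖σ E‖ₑ ≤ ∑ i, ‖(σ E i) • EuclideanSpace.single i (1 : ℝ)‖ₑ := by
        conv_lhs => rw [h1]
        exact enorm_sum_le _ _
    _ = ∑ i, ‖c i E‖ₑ := by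
        refine Finset.sum_congr rfl fun i _ => ?_
        rw [enorm_smul]
        have : ‖(EuclideanSpace.single i (1 : ℝ) : EuclideanSpace ℝ (Fin n))‖ₑ = 1 := by
          rw [← ofReal_norm]; simp
        rw [this, mul_one]; rfl
    _ ≤ ∑ i, (c i).variation E :=
        Finset.sum_le_sum fun i _ => VectorMeasure.enorm_measure_le_variation _ _

theorem measurable_polar (σ : VectorMeasure X E3) : Measurable (polar σ) := by
  refine (WithLp.measurable_toLp 2 _).comp (measurable_pi_lambda _ fun i => ?_)
  fin_cases i <;> exact SignedMeasure.measurable_rnDeriv _ _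

theorem polar_apply (σ : VectorMeasure X E3) (z : X) (i : Fin 3) :
    polar σ z i = (comp σ i).rnDeriv σ.variation z := by
  fin_cases i <;> rfl

theorem integrable_polar (σ : VectorMeasure X E3) : Integrable (polar σ) σ.variation := by
  refine ⟨(measurable_polar σ).aestronglyMeasurable, ?_⟩
  have h : Integrable (fun z => ∑ i, ‖(comp σ i).rnDeriv σ.variation z‖) σ.variation :=
    integrable_finsetSum _ fun i _ => (SignedMeasure.integrable_rnDeriv _ _).norm
  refine (h.mono' (measurable_polar σ).aestronglyMeasurable (ae_of_all _ fun z => ?_)).2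
  have h1 : polar σ z = ∑ i, (polar σ z i) • EuclideanSpace.single i (1 : ℝ) := by
    ext j
    simp [Finset.sum_apply, Pi.single_apply]
  conv_lhs => rw [h1]
  refine (norm_sum_le _ _).trans (Finset.sum_le_sum fun i _ => ?_)
  rw [norm_smul, polar_apply]; simp

/-- The polar decomposition of an `ℝ³`-valued measure. -/
theorem setIntegral_polar (σ : VectorMeasure X E3) {A : Set X} (hA : MeasurableSet A) :
    ∫ z in A, polar σ z ∂σ.variation = σ A := by
  have := isFiniteMeasure_variation σ
  ext i
  have h1 : (∫ z in A, polar σ z ∂σ.variation) i = ∫ z in A, polar σ z i ∂σ.variation :=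
    ((EuclideanSpace.proj (𝕜 := ℝ) i : E3 →L[ℝ] ℝ).integral_comp_comm
      (integrable_polar σ).integrableOn).symm
  rw [h1]
  simp_rw [polar_apply]
  rw [← withDensityᵥ_apply (SignedMeasure.integrable_rnDeriv _ _) hA,
    SignedMeasure.withDensityᵥ_rnDeriv_eq]
  · rfl
  · refine VectorMeasure.AbsolutelyContinuous.mk fun s hs h => ?_
    rw [Measure.toENNRealVectorMeasure_apply_measurable hs] at h
    have : σ s = 0 := by
      have := VectorMeasure.enorm_measure_le_variation σ s
      rw [h] at this; simpa using this
    change σ s i = 0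
    rw [this]; rfl

/-- `σ` vanishes on every measurable subset of the zero set of its density, hence so does its
variation. The representation of `h` by linear forms is only available at nonzero vectors. -/
theorem ae_polar_ne_zero (σ : VectorMeasure X E3) : ∀ᵐ z ∂σ.variation, polar σ z ≠ 0 := by
  have hm : MeasurableSet {z | polar σ z = 0} := measurable_polar σ (measurableSet_singleton 0)
  rw [ae_iff]
  simp only [not_not]
  rw [VectorMeasure.variation_apply_eq_zero hm]
  intro t hts ht
  rw [← setIntegral_polar σ ht,
    setIntegral_congr_fun (g := fun _ => (0 : E3)) ht (fun z hz => hts hz)]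
  simp

/-- If `σ` is the image under `π` of the vector measure with density `g`, then integrals against
`σ` are integrals against this density. -/
theorem pair_eq_integral {n : ℕ} (σ : VectorMeasure X (EuclideanSpace ℝ (Fin n)))
    {ν : Measure T} {π : T → X} (hπ : Measurable π) {g : T → EuclideanSpace ℝ (Fin n)}
    (hg : Integrable g ν) (h : ∀ A, MeasurableSet A → σ A = ∫ t in π ⁻¹' A, g t ∂ν)
    {φ : X → EuclideanSpace ℝ (Fin n)} (hφ : Measurable φ) {C : ℝ} (hC : ∀ x, ‖φ x‖ ≤ C) :
    pair φ σ = ∫ t, ⟪φ (π t), g t⟫_ℝ ∂ν := by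
  have := isFiniteMeasure_variation σ
  rcases isEmpty_or_nonempty X with hX | ⟨⟨x0⟩⟩
  · have : IsEmpty T := ⟨fun t => hX.elim (π t)⟩
    simp [pair, VectorMeasure.integral_of_isEmpty, integral_of_isEmpty]
  have hC0 : 0 ≤ C := (norm_nonneg _).trans (hC x0)
  have hint : ∀ s : SimpleFunc X (EuclideanSpace ℝ (Fin n)),
      Integrable (fun t => ⟪s (π t), g t⟫_ℝ) ν := fun s => by
    obtain ⟨D, hD⟩ := s.exists_forall_norm_le
    refine (hg.norm.const_mul D).mono'
      (((s.measurable.comp hπ).aestronglyMeasurable).inner hg.aestronglyMeasurable)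
      (ae_of_all _ fun t => ?_)
    exact (norm_inner_le_norm _ _).trans (mul_le_mul_of_nonneg_right (hD _) (norm_nonneg _))
  have hs : ∀ s : SimpleFunc X (EuclideanSpace ℝ (Fin n)),
      pair (s : X → _) σ = ∫ t, ⟪s (π t), g t⟫_ℝ ∂ν := by
    intro s
    induction s using SimpleFunc.induction with
    | const c hs =>
      rename_i A
      have e1 : ((SimpleFunc.piecewise A hs (SimpleFunc.const X c) (SimpleFunc.const X 0) :
          SimpleFunc X (EuclideanSpace ℝ (Fin n))) : X → _) = A.indicator fun _ => c := by
        ext x : 1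
        simp [SimpleFunc.coe_piecewise, Set.piecewise, Set.indicator]
      rw [e1, pair, VectorMeasure.integral_indicator_const _ hs, h A hs]
      have e2 : (fun t => ⟪A.indicator (fun _ => c) (π t), g t⟫_ℝ)
          = (π ⁻¹' A).indicator fun t => ⟪c, g t⟫_ℝ := by
        ext t
        by_cases ht : π t ∈ A <;> simp [Set.indicator, ht]
      rw [e2, MeasureTheory.integral_indicator (hπ hs), integral_inner hg.integrableOn]
      rfl
    | add _ h1 h2 =>
      rename_i s1 s2 _
      have e : ∫ t, ⟪(s1 + s2) (π t), g t⟫_ℝ ∂ν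
          = ∫ t, ⟪s1 (π t), g t⟫_ℝ + ⟪s2 (π t), g t⟫_ℝ ∂ν := by
        simp only [SimpleFunc.coe_add, Pi.add_apply, inner_add_left]
      rw [e, integral_add (hint s1) (hint s2), ← h1, ← h2, pair, SimpleFunc.coe_add,
        VectorMeasure.integral_add]
      · rfl
      · exact s1.integrable_of_isFiniteMeasure
      · exact s2.integrable_of_isFiniteMeasure
  have hφs := hφ.stronglyMeasurable
  -- The identity holds for simple fields by linearity; approximants bounded by the same `C` allow
  -- dominated convergence on both sides.
  let S := hφs.approxBounded C
  have l1 : Tendsto (fun k => pair (S k : X → _) σ) atTop (𝓝 (pair φ σ)) :=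
    VectorMeasure.tendsto_integral_of_dominated_convergence (fun _ => C)
      (fun k => (S k).measurable.aestronglyMeasurable) (integrable_const _)
      (fun k => ae_of_all _ fun x => hφs.norm_approxBounded_le hC0 k x)
      (ae_of_all _ fun x => hφs.tendsto_approxBounded_of_norm_le (hC x))
  have l2 : Tendsto (fun k => ∫ t, ⟪S k (π t), g t⟫_ℝ ∂ν) atTop
      (𝓝 (∫ t, ⟪φ (π t), g t⟫_ℝ ∂ν)) := by
    refine tendsto_integral_of_dominated_convergence (fun t => C * ‖g t‖)
      (fun k => (hint _).aestronglyMeasurable) (hg.norm.const_mul C) (fun k => ?_) ?_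
    · refine ae_of_all _ fun t => (norm_inner_le_norm _ _).trans
        (mul_le_mul_of_nonneg_right (hφs.norm_approxBounded_le hC0 k _) (norm_nonneg _))
    · exact ae_of_all _ fun t =>
        (hφs.tendsto_approxBounded_of_norm_le (hC _)).inner tendsto_const_nhds
  simp_rw [hs] at l1
  exact tendsto_nhds_unique l1 l2

theorem pair_eq_integral_polar (σ : VectorMeasure X E3) {φ : X → E3} (hφ : Measurable φ) {C : ℝ}
    (hC : ∀ x, ‖φ x‖ ≤ C) : pair φ σ = ∫ z, ⟪φ z, polar σ z⟫_ℝ ∂σ.variation :=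
  pair_eq_integral σ measurable_id (integrable_polar σ)
    (fun _ hA => (setIntegral_polar σ hA).symm) hφ hC

/-- The image under `π` of the vector measure with density `g`. -/
def pushDensity (ν : Measure T) (π : T → X) (g : T → E3) : VectorMeasure X E3 :=
  (ν.withDensityᵥ g).map π

theorem pushDensity_apply {ν : Measure T} {π : T → X} (hπ : Measurable π) {g : T → E3}
    (hg : Integrable g ν) {A : Set X} (hA : MeasurableSet A) :
    pushDensity ν π g A = ∫ t in π ⁻¹' A, g t ∂ν := by
  rw [pushDensity, VectorMeasure.map_apply _ hπ hA, withDensityᵥ_apply hg (hπ hA)]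

theorem pair_pushDensity {ν : Measure T} {π : T → X} (hπ : Measurable π) {g : T → E3}
    (hg : Integrable g ν) {φ : X → E3} (hφ : Measurable φ) {C : ℝ} (hC : ∀ x, ‖φ x‖ ≤ C) :
    pair φ (pushDensity ν π g) = ∫ t, ⟪φ (π t), g t⟫_ℝ ∂ν :=
  pair_eq_integral _ hπ hg (fun _ hA => pushDensity_apply hπ hg hA) hφ hC

end VectorMeasures

/-! ### Coordinates and frames in the plane and in space -/

section Plane

theorem continuous_dir : Continuous dir := by
  refine (PiLp.continuous_toLp 2 _).comp (continuous_pi fun i => ?_)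
  fin_cases i
  · exact Real.continuous_cos.quotient_lift _
  · exact Real.continuous_sin.quotient_lift _

theorem dir_sq (θ : S1) : dir θ 0 ^ 2 + dir θ 1 ^ 2 = 1 := by
  induction θ using QuotientAddGroup.induction_on with
  | H x => exact Real.cos_sq_add_sin_sq x

theorem norm_dir (θ : S1) : ‖dir θ‖ = 1 := by
  rw [EuclideanSpace.norm_eq, Fin.sum_univ_two]
  simp only [Real.norm_eq_abs, sq_abs, dir_sq, Real.sqrt_one]

theorem inner_plane (v w : E2) : ⟪v, w⟫_ℝ = v 0 * w 0 + v 1 * w 1 := by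
  simp [PiLp.inner_apply, Fin.sum_univ_two, mul_comm]

theorem inner_space (v w : E3) : ⟪v, w⟫_ℝ = v 0 * w 0 + v 1 * w 1 + v 2 * w 2 := by
  simp [PiLp.inner_apply, Fin.sum_univ_three, mul_comm]

@[simp] theorem perp_zero_coord (v : E2) : perp v 0 = v 1 := rfl

@[simp] theorem perp_one_coord (v : E2) : perp v 1 = -v 0 := rfl

@[simp] theorem join_zero_coord (a : E2) (t : ℝ) : join a t 0 = a 0 := rfl

@[simp] theorem join_one_coord (a : E2) (t : ℝ) : join a t 1 = a 1 := rfl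

@[simp] theorem join_two_coord (a : E2) (t : ℝ) : join a t 2 = t := rfl

@[simp] theorem spat_join (a : E2) (t : ℝ) : spat (join a t) = a := by
  ext i; fin_cases i <;> rfl

theorem inner_join (a : E2) (t : ℝ) (p : E3) : ⟪join a t, p⟫_ℝ = ⟪a, spat p⟫_ℝ + t * p 2 := by
  rw [inner_space, inner_plane]; rfl

theorem join_add (a b : E2) (s t : ℝ) : join (a + b) (s + t) = join a s + join b t := by
  ext i; fin_cases i <;> rfl

theorem join_smul (c : ℝ) (a : E2) (t : ℝ) : join (c • a) (c * t) = c • join a t := by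
  ext i; fin_cases i <;> rfl

theorem continuous_join : Continuous fun q : E2 × ℝ => join q.1 q.2 := by
  refine (PiLp.continuous_toLp 2 _).comp (continuous_pi fun i => ?_)
  fin_cases i
  · exact (EuclideanSpace.proj (𝕜 := ℝ) (0 : Fin 2)).continuous.comp continuous_fst
  · exact (EuclideanSpace.proj (𝕜 := ℝ) (1 : Fin 2)).continuous.comp continuous_fst
  · exact continuous_snd

theorem continuous_spat : Continuous spat := by
  refine (PiLp.continuous_toLp 2 _).comp (continuous_pi fun i => ?_)
  fin_cases i
  · exact (EuclideanSpace.proj (𝕜 := ℝ) (0 : Fin 3)).continuous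
  · exact (EuclideanSpace.proj (𝕜 := ℝ) (1 : Fin 3)).continuous

theorem norm_spat_le (p : E3) : ‖spat p‖ ≤ ‖p‖ := by
  rw [EuclideanSpace.norm_eq, EuclideanSpace.norm_eq, Fin.sum_univ_two, Fin.sum_univ_three]
  exact Real.sqrt_le_sqrt (le_add_of_nonneg_right (by positivity))

theorem norm_join_le (a : E2) (t : ℝ) : ‖join a t‖ ≤ ‖a‖ + |t| := by
  have h : join a t = join a 0 + join 0 t := by rw [← join_add]; simp
  rw [h]
  refine (norm_add_le _ _).trans (add_le_add (le_of_eq ?_) (le_of_eq ?_))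
  · simp [EuclideanSpace.norm_eq, Fin.sum_univ_two, Fin.sum_univ_three]
  · simp [EuclideanSpace.norm_eq, Fin.sum_univ_three, Real.sqrt_sq_eq_abs]

theorem eq_dir_add_perp (θ : S1) (v : E2) :
    v = ⟪dir θ, v⟫_ℝ • dir θ + ⟪perp (dir θ), v⟫_ℝ • perp (dir θ) := by
  have h := dir_sq θ
  ext i
  fin_cases i
  · simp [inner_plane]; linear_combination -(v 0) * h
  · simp [inner_plane]; linear_combination -(v 1) * h

theorem inner_perp_dir_self (θ : S1) : ⟪perp (dir θ), dir θ⟫_ℝ = 0 := by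
  simp [inner_plane]; ring

theorem inner_dir_self (θ : S1) : ⟪dir θ, dir θ⟫_ℝ = 1 := by
  rw [real_inner_self_eq_norm_sq, norm_dir, one_pow]

end Plane

/-! ### Affine minorants of the integrand -/

section Convex

/-- The coefficients `(a, b)` of the affine functions `t ↦ a + b t` below `f`. -/
def affineMinorants (f : ℝ → ℝ≥0∞) : Set (ℝ × ℝ) :=
  {q | ∀ t, ENNReal.ofReal (q.1 + q.2 * t) ≤ f t}

variable {f : ℝ → ℝ≥0∞}

theorem zero_mem_affineMinorants : (0 : ℝ × ℝ) ∈ affineMinorants f := fun t => by simp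

/-- Unfolding the conjugate, the left side reads `r + s t ≤ f t` for all `t`; since `f ≥ 0`,
truncating `r + s t` at zero loses nothing. This turns the dual constraint into membership in the
set that represents `h`. -/
theorem add_conj_nonpos_iff {r s : ℝ} :
    (r : EReal) + conj f s ≤ 0 ↔ (r, s) ∈ affineMinorants f := by
  have h : (r : EReal) + conj f s ≤ 0 ↔ conj f s ≤ ((-r : ℝ) : EReal) := by
    rw [add_comm]
    constructor
    · intro h
      have := EReal.le_sub_iff_add_le (a := conj f s) (b := (r : EReal)) (c := 0)
        (by simp) (by simp)
      simpa using this.2 h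
    · intro h
      calc conj f s + r ≤ ((-r : ℝ) : EReal) + r := by gcongr
        _ = 0 := by rw [← EReal.coe_add]; simp
  rw [h, conj, iSup_le_iff]
  refine forall_congr' fun t => ?_
  change _ ↔ ENNReal.ofReal (r + s * t) ≤ f t
  rcases eq_or_ne (f t) ⊤ with ht | ht
  · simp [ht]
  · rw [← ENNReal.ofReal_toReal ht, EReal.coe_ennreal_ofReal, max_eq_left ENNReal.toReal_nonneg,
      ENNReal.ofReal_le_ofReal_iff ENNReal.toReal_nonneg, ← EReal.coe_sub, EReal.coe_le_coe_iff]
    constructor <;> intro h <;> linarith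

/-- A convex lower semicontinuous function is the supremum of its affine minorants. -/
theorem exists_affineMinorant_gt (hc : ConvexOn ℝ≥0 univ f) (hl : LowerSemicontinuous f)
    {τ : ℝ} {c : ℝ≥0∞} (h : c < f τ) :
    ∃ q ∈ affineMinorants f, c < ENNReal.ofReal (q.1 + q.2 * τ) := by
  obtain ⟨y, rfl⟩ : ∃ y : ℝ≥0, c = y := ⟨c.toNNReal, (ENNReal.coe_toNNReal h.ne_top).symm⟩
  have key : ∀ q : ℝ × ℝ, (y : ℝ) < q.1 + q.2 * τ →
      (y : ℝ≥0∞) < ENNReal.ofReal (q.1 + q.2 * τ) := fun q hq => by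
    rw [← ENNReal.ofReal_coe_nnreal]
    exact (ENNReal.ofReal_lt_ofReal_iff (y.2.trans_lt hq)).2 hq
  let E : Set (ℝ × ℝ) := {p | f p.1 ≤ ENNReal.ofReal p.2 ∧ 0 ≤ p.2}
  have hEc : Convex ℝ E := by
    rintro ⟨x, s⟩ ⟨h1, h2⟩ ⟨x', s'⟩ ⟨h1', h2'⟩ a b ha hb hab
    refine ⟨?_, add_nonneg (mul_nonneg ha h2) (mul_nonneg hb h2')⟩
    have := hc.2 (mem_univ x) (mem_univ x') (show (0 : ℝ≥0) ≤ ⟨a, ha⟩ from zero_le)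
      (show (0 : ℝ≥0) ≤ ⟨b, hb⟩ from zero_le) (NNReal.eq hab)
    refine this.trans ?_
    simp only [Prod.snd_add, Prod.smul_snd, smul_eq_mul]
    rw [ENNReal.ofReal_add (mul_nonneg ha h2) (mul_nonneg hb h2'), ENNReal.ofReal_mul ha,
      ENNReal.ofReal_mul hb]
    rw [ENNReal.ofReal_eq_coe_nnreal ha, ENNReal.ofReal_eq_coe_nnreal hb]
    exact add_le_add (mul_le_mul_right h1 _) (mul_le_mul_right h1' _)
  have hEcl : IsClosed E := by
    refine IsClosed.inter ?_ (isClosed_le continuous_const continuous_snd)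
    exact (lowerSemicontinuous_iff_isClosed_epigraph.1 hl).preimage
      (continuous_fst.prodMk (ENNReal.continuous_ofReal.comp continuous_snd))
  have hmem : ∀ t, f t ≠ ⊤ → (t, (f t).toReal) ∈ E := fun t ht =>
    ⟨by simp [ENNReal.ofReal_toReal ht], ENNReal.toReal_nonneg⟩
  have hτ : (τ, (y : ℝ)) ∉ E := fun hE => absurd hE.1 (by simpa using h)
  obtain ⟨L, u, h1, h2⟩ := geometric_hahn_banach_point_closed hEc hEcl hτ
  set α := L (1, 0)
  set β := L (0, 1)
  have hL : ∀ x s, L (x, s) = α * x + β * s := fun x s => by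
    have : ((x, s) : ℝ × ℝ) = x • ((1 : ℝ), (0 : ℝ)) + s • ((0 : ℝ), (1 : ℝ)) := by simp
    rw [this, map_add, map_smul, map_smul, smul_eq_mul, smul_eq_mul]; ring
  rw [hL] at h1
  by_cases hE : ∀ t, f t = ⊤
  · exact ⟨(y + 1, 0), fun t => by simp [hE t], key _ (by simp)⟩
  push Not at hE
  obtain ⟨x0, hx0⟩ := hE
  -- The epigraph is unbounded upwards, so the separating functional cannot decrease with the
  -- height.
  have hβ : 0 ≤ β := by
    by_contra! hβ
    set s0 := (f x0).toReal
    obtain ⟨k, hk⟩ := exists_nat_gt ((u - α * x0 - β * s0) / β)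
    have hk' := h2 (x0, s0 + k) ⟨(hmem x0 hx0).1.trans (ENNReal.ofReal_le_ofReal (by simp [s0])),
      add_nonneg (hmem x0 hx0).2 k.cast_nonneg⟩
    rw [hL] at hk'
    rw [div_lt_iff_of_neg hβ] at hk
    linarith
  have mk : ∀ q : ℝ × ℝ, (∀ t s, (t, s) ∈ E → q.1 + q.2 * t ≤ s) → q ∈ affineMinorants f := by
    intro q hq t
    rcases eq_or_ne (f t) ⊤ with ht | ht
    · simp [ht]
    · rw [← ENNReal.ofReal_toReal ht]
      exact ENNReal.ofReal_le_ofReal (hq _ _ (hmem t ht))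
  rcases hβ.eq_or_lt with hβ | hβ
  -- Vertical hyperplane: `u - α t` is negative where `f` is finite and positive at `τ`. Since `f ≥
  -- 0`, every multiple `k (u - α t)` is a minorant, and a large `k` exceeds `y` at `τ`.
  · have hd : 0 < u - α * τ := by rw [← hβ] at h1; linarith
    obtain ⟨k, hk⟩ := exists_nat_gt (y / (u - α * τ))
    rw [div_lt_iff₀ hd] at hk
    refine ⟨(k * u, -(k * α)), mk _ fun t s hts => ?_, key _ (by linarith)⟩
    have := h2 _ hts
    rw [hL, ← hβ] at this
    have h3 : (k : ℝ) * (u - α * t) ≤ 0 :=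
      mul_nonpos_of_nonneg_of_nonpos k.cast_nonneg (by linarith)
    have := hts.2
    simp only at this ⊢
    linarith
  · refine ⟨(u / β, -(α / β)), mk _ fun t s hts => ?_, key _ ?_⟩
    · have := h2 _ hts
      rw [hL] at this
      have e : u / β + -(α / β) * t = (u - α * t) / β := by field_simp; ring
      simp only [e]
      rw [div_le_iff₀ hβ]; linarith
    · have e : u / β + -(α / β) * τ = (u - α * τ) / β := by field_simp; ring
      simp only [e]
      rw [lt_div_iff₀ hβ]; linarith

end Convex

/-! ### The integrand as a supremum of linear forms -/

section Integrand

variable {f : ℝ → ℝ≥0∞}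

/-- The vector `(a θ + d θ^⊥, b)`, for `q = ((a, b), d)`. -/
def dualVec (θ : S1) (q : (ℝ × ℝ) × ℝ) : E3 :=
  join (q.1.1 • dir θ + q.2 • perp (dir θ)) q.1.2

theorem continuous_dualVec : Continuous fun z : S1 × ((ℝ × ℝ) × ℝ) => dualVec z.1 z.2 := by
  have h := continuous_dir
  refine continuous_join.comp (Continuous.prodMk (Continuous.add ?_ ?_) (by fun_prop))
  · exact (continuous_fst.comp (continuous_fst.comp continuous_snd)).smul (h.comp continuous_fst)
  · exact (continuous_snd.comp continuous_snd).smul (perp.continuous.comp (h.comp continuous_fst))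

theorem norm_dualVec_le (θ : S1) (q : (ℝ × ℝ) × ℝ) :
    ‖dualVec θ q‖ ≤ |q.1.1| + |q.2| + |q.1.2| := by
  refine (norm_join_le _ _).trans (add_le_add_left ((norm_add_le _ _).trans ?_) _)
  have h : ‖perp (dir θ)‖ = 1 := by
    have := dir_sq θ
    rw [EuclideanSpace.norm_eq, Fin.sum_univ_two]
    simp only [Real.norm_eq_abs, sq_abs, perp_zero_coord, perp_one_coord]
    rw [neg_sq, add_comm, this, Real.sqrt_one]
  rw [norm_smul, norm_smul, norm_dir, h, mul_one, mul_one]; rfl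

theorem inner_dualVec (θ : S1) (q : (ℝ × ℝ) × ℝ) (p : E3) :
    ⟪dualVec θ q, p⟫_ℝ
      = q.1.1 * ⟪dir θ, spat p⟫_ℝ + q.2 * ⟪perp (dir θ), spat p⟫_ℝ + q.1.2 * p 2 := by
  rw [dualVec, inner_join, inner_add_left, real_inner_smul_left, real_inner_smul_left]

theorem inner_dualVec_ray (θ : S1) (q : (ℝ × ℝ) × ℝ) {p : E3} {r : ℝ} (hp : spat p = r • dir θ) :
    ⟪dualVec θ q, p⟫_ℝ = q.1.1 * r + q.1.2 * p 2 := by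
  rw [inner_dualVec, hp, real_inner_smul_right, real_inner_smul_right, inner_dir_self,
    inner_perp_dir_self]
  ring

theorem le_recession {q : ℝ × ℝ} (hq : q ∈ affineMinorants f) (t : ℝ) :
    ENNReal.ofReal (q.2 * t) ≤ recession f t := by
  have h1 : Tendsto (fun s : ℝ => ENNReal.ofReal (q.1 / s + q.2 * t)) atTop
      (𝓝 (ENNReal.ofReal (q.2 * t))) := by
    refine (ENNReal.continuous_ofReal.tendsto _).comp ?_
    simpa using (tendsto_const_nhds.div_atTop tendsto_id).add_const (q.2 * t)
  rw [← h1.limsup_eq]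
  refine limsup_le_limsup ?_
  filter_upwards [eventually_gt_atTop 0] with s hs
  have e : q.1 / s + q.2 * t = (q.1 + q.2 * (s * t)) / s := by field_simp
  rw [e, ENNReal.ofReal_div_of_pos hs]
  exact ENNReal.div_le_div_right (hq _) _

/-- Every element of the polar set is below the integrand, along the ray of `dir θ`. -/
theorem affineMinorant_le_hfun {q : ℝ × ℝ} (hq : q ∈ affineMinorants f) {θ : S1} {p : E3} {r : ℝ}
    (hr : 0 ≤ r) (hp : spat p = r • dir θ) :
    ENNReal.ofReal (q.1 * r + q.2 * p 2) ≤ hfun f θ p := by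
  have hn : ‖spat p‖ = r := by rw [hp, norm_smul, norm_dir, mul_one, Real.norm_of_nonneg hr]
  rcases hr.eq_or_lt with rfl | hr'
  · rw [zero_smul] at hp
    rw [hfun, if_pos hp, mul_zero, zero_add]
    exact le_recession hq _
  · have h0 : spat p ≠ 0 := fun h => by rw [h, norm_zero] at hn; exact hr'.ne hn
    rw [hfun, if_neg h0, if_pos ⟨r, hr, hp⟩, hn]
    have e : q.1 * r + q.2 * p 2 = r * (q.1 + q.2 * (p 2 / r)) := by field_simp
    rw [e, ENNReal.ofReal_mul hr]
    gcongr
    exact hq _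

/-- A minorant nearly touching `f` at the far point `s t` stays below `f x0` at a fixed point `x0`
of the domain, so its slope between the two is almost `f (s t) / s`, up to an error that vanishes as
`s` grows. -/
theorem exists_affineMinorant_gt_recession (hc : ConvexOn ℝ≥0 univ f)
    (hl : LowerSemicontinuous f) {t : ℝ} (ht : t ≠ 0) {c : ℝ≥0∞} (h : c < recession f t) :
    ∃ q ∈ affineMinorants f, c < ENNReal.ofReal (q.2 * t) := by
  obtain ⟨d, hcd, hd⟩ := exists_between h
  obtain ⟨y, rfl⟩ : ∃ y : ℝ≥0, c = y := ⟨c.toNNReal, (ENNReal.coe_toNNReal h.ne_top).symm⟩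
  obtain ⟨z, rfl⟩ : ∃ z : ℝ≥0, d = z := ⟨d.toNNReal, (ENNReal.coe_toNNReal hd.ne_top).symm⟩
  have hyz : (y : ℝ) < z := by exact_mod_cast hcd
  have key : ∀ b : ℝ, (y : ℝ) < b * t → (y : ℝ≥0∞) < ENNReal.ofReal (b * t) := fun b hb => by
    rw [← ENNReal.ofReal_coe_nnreal]
    exact (ENNReal.ofReal_lt_ofReal_iff (y.2.trans_lt hb)).2 hb
  by_cases hE : ∀ t, f t = ⊤
  · exact ⟨(0, (y + 1) / t), fun t => by simp [hE t], key _ (by field_simp; linarith)⟩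
  push Not at hE
  obtain ⟨x0, hx0⟩ := hE
  set m := (f x0).toReal
  have hfreq : ∃ᶠ s in atTop, (z : ℝ≥0∞) < f (s * t) / ENNReal.ofReal s :=
    frequently_lt_of_lt_limsup (by isBoundedDefault) hd
  -- The last threshold is equivalent to `z * s - m ≥ y * (s - x0 / t)`, which absorbs the value `m`
  -- at `x0`.
  obtain ⟨s, hs, hs0, hsx, hsm⟩ := (hfreq.and_eventually
    ((eventually_gt_atTop 0).and ((eventually_gt_atTop (x0 / t)).and
      (eventually_ge_atTop ((m - y * (x0 / t)) / (z - y)))))).exists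
  rw [ENNReal.lt_div_iff_mul_lt (by simp [hs0]) (by simp)] at hs
  obtain ⟨q, hq, hlt⟩ := exists_affineMinorant_gt hc hl hs
  refine ⟨q, hq, key _ ?_⟩
  rw [← ENNReal.ofReal_coe_nnreal, ← ENNReal.ofReal_mul (NNReal.coe_nonneg z),
    ENNReal.ofReal_lt_ofReal_iff'] at hlt
  have h1 := hlt.1
  have h2 : q.1 + q.2 * x0 ≤ m := by
    have := hq x0
    rw [← ENNReal.ofReal_toReal hx0] at this
    exact (ENNReal.ofReal_le_ofReal_iff ENNReal.toReal_nonneg).1 this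
  rw [div_le_iff₀ (by linarith)] at hsm
  have h3 : y * (s - x0 / t) < (q.2 * t) * (s - x0 / t) := by
    have e : (q.2 * t) * (s - x0 / t) = q.2 * (s * t) - q.2 * x0 := by field_simp
    rw [e]; linarith
  exact lt_of_mul_lt_mul_right h3 (by linarith)

theorem lt_hfun_imp_exists (hc : ConvexOn ℝ≥0 univ f) (hl : LowerSemicontinuous f) {θ : S1}
    {p : E3} (hp : p ≠ 0) {c : ℝ≥0∞} (h : c < hfun f θ p) :
    ∃ q ∈ affineMinorants f, ∃ d : ℝ, c < ENNReal.ofReal ⟪dualVec θ (q, d), p⟫_ℝ := by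
  by_cases h0 : spat p = 0
  · have h2 : p 2 ≠ 0 := fun h2 => hp <| by
      ext i; fin_cases i
      · exact congrArg (fun v : E2 => v 0) h0
      · exact congrArg (fun v : E2 => v 1) h0
      · exact h2
    rw [hfun, if_pos h0] at h
    obtain ⟨q, hq, hlt⟩ := exists_affineMinorant_gt_recession hc hl h2 h
    refine ⟨q, hq, 0, ?_⟩
    rw [inner_dualVec_ray θ _ (r := 0) (by rw [h0, zero_smul])]
    simpa using hlt
  by_cases hr : ∃ r : ℝ, 0 ≤ r ∧ spat p = r • dir θ
  · rw [hfun, if_neg h0, if_pos hr] at h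
    obtain ⟨r, hr, hpr⟩ := hr
    have hn : ‖spat p‖ = r := by rw [hpr, norm_smul, norm_dir, mul_one, Real.norm_of_nonneg hr]
    have hr' : 0 < r := hn ▸ norm_pos_iff.2 h0
    rw [hn, mul_comm, ← ENNReal.div_lt_iff (Or.inl (by simp [hr'])) (Or.inl (by simp))] at h
    obtain ⟨q, hq, hlt⟩ := exists_affineMinorant_gt hc hl h
    refine ⟨q, hq, 0, ?_⟩
    rw [inner_dualVec_ray θ _ hpr]
    rw [ENNReal.div_lt_iff (Or.inl (by simp [hr'])) (Or.inl (by simp)), mul_comm,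
      ← ENNReal.ofReal_mul hr] at hlt
    have e : r * (q.1 + q.2 * (p 2 / r)) = q.1 * r + q.2 * p 2 := by field_simp
    rwa [e] at hlt
  -- Off the ray the forms are unbounded: a nonzero transverse component `β` is scaled by the free
  -- multiplier, and a negative multiple of `dir θ` is detected by negative constants, which are
  -- minorants of `f ≥ 0`.
  · have hct : c < ⊤ := h.trans_le le_top
    obtain ⟨k, hk⟩ := ENNReal.exists_nat_gt hct.ne
    have hk' : c < ENNReal.ofReal (k : ℝ) := by simpa using hk
    set α := ⟪dir θ, spat p⟫_ℝ with hα
    set β := ⟪perp (dir θ), spat p⟫_ℝ with hβ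
    by_cases hβ0 : β = 0
    · have hα0 : α < 0 := by
        by_contra! hα0
        refine hr ⟨α, hα0, ?_⟩
        have := eq_dir_add_perp θ (spat p)
        rwa [← hα, ← hβ, hβ0, zero_smul, add_zero] at this
      refine ⟨(k / α, 0), fun t => ?_, 0, ?_⟩
      · have : (k : ℝ) / α ≤ 0 := div_nonpos_of_nonneg_of_nonpos k.cast_nonneg hα0.le
        simp [ENNReal.ofReal_of_nonpos this]
      · rw [inner_dualVec, ← hα]
        have := hα0.ne
        have e : (k : ℝ) / α * α + 0 * ⟪perp (dir θ), spat p⟫_ℝ + 0 * p 2 = k := by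
          field_simp; ring
        simp only [e]; exact hk'
    · refine ⟨0, zero_mem_affineMinorants, k / β, ?_⟩
      rw [inner_dualVec, ← hα, ← hβ]
      have e : (0 : ℝ × ℝ).1 * α + k / β * β + (0 : ℝ × ℝ).2 * p 2 = k := by
        simp [hβ0]
      simp only [e]; exact hk'

/-- The integrand is a countable supremum of linear functions. -/
theorem exists_seq_hfun_le (hc : ConvexOn ℝ≥0 univ f) (hl : LowerSemicontinuous f) :
    ∃ ξ : ℕ → (ℝ × ℝ) × ℝ, (∀ n, (ξ n).1 ∈ affineMinorants f) ∧ ∀ (θ : S1) (p : E3), p ≠ 0 →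
      hfun f θ p ≤ ⨆ n, ENNReal.ofReal ⟪dualVec θ (ξ n), p⟫_ℝ := by
  let A : Type := {q : (ℝ × ℝ) × ℝ // q.1 ∈ affineMinorants f}
  have : Nonempty A := ⟨⟨(0, 0), zero_mem_affineMinorants⟩⟩
  refine ⟨fun n => (TopologicalSpace.denseSeq A n).1, fun n => (TopologicalSpace.denseSeq A n).2,
    fun θ p hp => le_of_forall_lt fun c hlt => ?_⟩
  obtain ⟨q, hq, d, hqd⟩ := lt_hfun_imp_exists hc hl hp hlt
  have hcont : Continuous fun a : A => ENNReal.ofReal ⟪dualVec θ a.1, p⟫_ℝ := by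
    refine ENNReal.continuous_ofReal.comp (Continuous.inner ?_ continuous_const)
    exact continuous_dualVec.comp (continuous_const.prodMk continuous_subtype_val)
  -- Exceeding `c` at the fixed `p` is an open condition on the coefficients, so some member of the
  -- dense sequence satisfies it.
  obtain ⟨n, hn⟩ := (TopologicalSpace.denseRange_denseSeq A).exists_mem_open
    (isOpen_lt continuous_const hcont) ⟨⟨(q, d), hq⟩, hqd⟩
  exact lt_of_lt_of_le hn (le_iSup (fun n => ENNReal.ofReal
    ⟪dualVec θ (TopologicalSpace.denseSeq A n).1, p⟫_ℝ) n)

end Integrand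

/-! ### Gradients of functions on the plane times the circle -/

section TestFunctions

variable {Ω : Set E2} {φ : E2 × S1 → ℝ}

theorem isOpenQuotientMap_unroll :
    IsOpenQuotientMap (fun q : E2 × ℝ => ((q.1, (q.2 : S1)) : E2 × S1)) :=
  IsOpenQuotientMap.id.prodMap QuotientAddGroup.isOpenQuotientMap_mk

/-- The covering map is an open quotient map, so it carries neighbourhood filters onto neighbourhood
filters. Continuity of gradients can thus be read off from periodic functions. -/
theorem continuousAt_iff_unroll {Y : Type*} [TopologicalSpace Y] {g : E2 × S1 → Y} {x : E2}
    {t : ℝ} : ContinuousAt g (x, (t : S1)) ↔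
      ContinuousAt (fun q : E2 × ℝ => g (q.1, (q.2 : S1))) (x, t) := by
  have h := isOpenQuotientMap_unroll
  rw [ContinuousAt, ContinuousAt, ← h.map_nhds_eq (x, t), tendsto_map'_iff]
  rfl

theorem hasGradientAt_unroll {x : E2} {t : ℝ} (h : DifferentiableAt ℝ (unroll φ) (x, t)) :
    HasGradientAt (fun y : E2 => φ (y, (t : S1)))
      ((InnerProductSpace.toDual ℝ E2).symm
        ((fderiv ℝ (unroll φ) (x, t)).comp (ContinuousLinearMap.inl ℝ E2 ℝ))) x := by
  rw [hasGradientAt_iff_hasFDerivAt, LinearIsometryEquiv.apply_symm_apply]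
  exact HasFDerivAt.comp (g := unroll φ) (f := fun y : E2 => (y, t)) x h.hasFDerivAt
    (hasFDerivAt_prodMk_left x t)

theorem gradX_coe {x : E2} {t : ℝ} (h : DifferentiableAt ℝ (unroll φ) (x, t)) :
    gradX φ (x, (t : S1)) = (InnerProductSpace.toDual ℝ E2).symm
        ((fderiv ℝ (unroll φ) (x, t)).comp (ContinuousLinearMap.inl ℝ E2 ℝ)) :=
  (hasGradientAt_unroll h).gradient

theorem dTheta_coe {x : E2} {t : ℝ} (h : DifferentiableAt ℝ (unroll φ) (x, t)) :
    dTheta φ (x, (t : S1)) = fderiv ℝ (unroll φ) (x, t) (0, 1) := by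
  have h1 : HasDerivAt (fun s : ℝ => (x, t + s)) ((0 : E2), (1 : ℝ)) 0 :=
    (hasDerivAt_const _ _).prodMk ((hasDerivAt_id 0).const_add t)
  have h2 : HasFDerivAt (unroll φ) (fderiv ℝ (unroll φ) (x, t)) (x, t + 0) := by
    rw [add_zero]; exact h.hasFDerivAt
  exact (h2.comp_hasDerivAt 0 h1).deriv

theorem eventually_differentiableAt_unroll {x : E2} {t : ℝ}
    (h : ContDiffAt ℝ 1 (unroll φ) (x, t)) :
    ∀ᶠ q in 𝓝 (x, t), DifferentiableAt ℝ (unroll φ) q :=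
  (h.eventually (by simp)).mono fun _ hq => hq.differentiableAt one_ne_zero

theorem continuousAt_gradX {x : E2} {t : ℝ} (h : ContDiffAt ℝ 1 (unroll φ) (x, t)) :
    ContinuousAt (gradX φ) (x, (t : S1)) := by
  rw [continuousAt_iff_unroll]
  have h1 : ContinuousAt (fun q => (InnerProductSpace.toDual ℝ E2).symm
        ((fderiv ℝ (unroll φ) q).comp (ContinuousLinearMap.inl ℝ E2 ℝ))) (x, t) :=
    (InnerProductSpace.toDual ℝ E2).symm.continuous.continuousAt.comp
      ((h.fderiv_right (m := 0) (by simp)).continuousAt.clm_comp continuousAt_const)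
  refine h1.congr ?_
  filter_upwards [eventually_differentiableAt_unroll h] with q hq using (gradX_coe hq).symm

theorem continuousAt_dTheta {x : E2} {t : ℝ} (h : ContDiffAt ℝ 1 (unroll φ) (x, t)) :
    ContinuousAt (dTheta φ) (x, (t : S1)) := by
  rw [continuousAt_iff_unroll]
  have h1 : ContinuousAt (fun q => fderiv ℝ (unroll φ) q ((0 : E2), (1 : ℝ))) (x, t) :=
    (h.fderiv_right (m := 0) (by simp)).continuousAt.clm_apply continuousAt_const
  refine h1.congr ?_
  filter_upwards [eventually_differentiableAt_unroll h] with q hq using (dTheta_coe hq).symm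

/-- The full gradient `(∇_x φ, ∂_θ φ)`. -/
def grad (φ : E2 × S1 → ℝ) (z : E2 × S1) : E3 := join (gradX φ z) (dTheta φ z)

theorem continuousAt_grad {z : E2 × S1}
    (h : ∀ t : ℝ, (t : S1) = z.2 → ContDiffAt ℝ 1 (unroll φ) (z.1, t)) :
    ContinuousAt (grad φ) z := by
  obtain ⟨x, θ⟩ := z
  obtain ⟨t, rfl⟩ := QuotientAddGroup.mk_surjective θ
  exact continuous_join.continuousAt.comp
    ((continuousAt_gradX (h t rfl)).prodMk (continuousAt_dTheta (h t rfl)))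

theorem IsTest.continuous_grad (h : IsTest Ω φ) : Continuous (grad φ) :=
  continuous_iff_continuousAt.2 fun _ => continuousAt_grad fun _ _ => h.1.contDiffAt

theorem grad_eq_zero_of_eventuallyEq {z : E2 × S1} (h : φ =ᶠ[𝓝 z] 0) : grad φ z = 0 := by
  have h1 : (fun y : E2 => φ (y, z.2)) =ᶠ[𝓝 z.1] fun _ => 0 :=
    (Continuous.tendsto (by fun_prop : Continuous fun y : E2 => (y, z.2)) z.1).eventually h
  have h2 : (fun t : ℝ => φ (z.1, z.2 + (t : S1))) =ᶠ[𝓝 0] fun _ => 0 := by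
    have hc : Continuous fun t : ℝ => (z.1, z.2 + (t : S1)) :=
      continuous_const.prodMk (continuous_const.add (AddCircle.continuous_mk' _))
    have := hc.tendsto 0
    simp only [AddCircle.coe_zero, add_zero] at this
    exact this.eventually h
  have e1 : gradX φ z = 0 := by
    rw [gradX, h1.gradient_eq]; exact gradient_fun_const _ _
  have e2 : dTheta φ z = 0 := by rw [dTheta, h2.deriv_eq]; simp
  rw [grad, e1, e2]
  ext i; fin_cases i <;> rfl

theorem support_grad_subset : Function.support (grad φ) ⊆ tsupport φ := fun z hz => by
  by_contra h
  exact hz (grad_eq_zero_of_eventuallyEq (notMem_tsupport_iff_eventuallyEq.1 h))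

theorem IsTest.hasCompactSupport_grad (h : IsTest Ω φ) : HasCompactSupport (grad φ) :=
  HasCompactSupport.intro' h.2.1 (isClosed_tsupport _)
    fun _ hz => Function.notMem_support.1 fun h' => hz (support_grad_subset h')

theorem IsTest.exists_norm_grad_le (h : IsTest Ω φ) : ∃ C, ∀ z, ‖grad φ z‖ ≤ C :=
  h.hasCompactSupport_grad.exists_bound_of_continuous h.continuous_grad

theorem IsTest.differentiableAt (h : IsTest Ω φ) (q : E2 × ℝ) :
    DifferentiableAt ℝ (unroll φ) q := h.1.differentiable one_ne_zero q

theorem grad_add {ψ : E2 × S1 → ℝ} {x : E2} {t : ℝ} (h : DifferentiableAt ℝ (unroll φ) (x, t))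
    (h' : DifferentiableAt ℝ (unroll ψ) (x, t)) :
    grad (φ + ψ) (x, (t : S1)) = grad φ (x, (t : S1)) + grad ψ (x, (t : S1)) := by
  have h2 : DifferentiableAt ℝ (unroll (φ + ψ)) (x, t) := h.add h'
  have e : fderiv ℝ (unroll (φ + ψ)) (x, t)
      = fderiv ℝ (unroll φ) (x, t) + fderiv ℝ (unroll ψ) (x, t) := fderiv_add h h'
  rw [grad, grad, grad, ← join_add, dTheta_coe h2, dTheta_coe h, dTheta_coe h', e, gradX_coe h2,
    gradX_coe h, gradX_coe h', e, ContinuousLinearMap.add_comp, map_add]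
  rfl

theorem grad_mul {ψ : E2 × S1 → ℝ} {x : E2} {t : ℝ} (h : DifferentiableAt ℝ (unroll φ) (x, t))
    (h' : DifferentiableAt ℝ (unroll ψ) (x, t)) :
    grad (φ * ψ) (x, (t : S1))
      = φ (x, (t : S1)) • grad ψ (x, (t : S1)) + ψ (x, (t : S1)) • grad φ (x, (t : S1)) := by
  have h2 : DifferentiableAt ℝ (unroll (φ * ψ)) (x, t) := h.mul h'
  have e : fderiv ℝ (unroll (φ * ψ)) (x, t) = unroll φ (x, t) • fderiv ℝ (unroll ψ) (x, t)
      + unroll ψ (x, t) • fderiv ℝ (unroll φ) (x, t) := fderiv_mul h h'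
  rw [grad, grad, grad, ← join_smul, ← join_smul, ← join_add, dTheta_coe h2, dTheta_coe h,
    dTheta_coe h', e, gradX_coe h2, gradX_coe h, gradX_coe h', e, ContinuousLinearMap.add_comp,
    ContinuousLinearMap.smul_comp, ContinuousLinearMap.smul_comp, map_add, map_smul, map_smul]
  rfl

theorem grad_const_smul (c : ℝ) {x : E2} {t : ℝ} (h : DifferentiableAt ℝ (unroll φ) (x, t)) :
    grad (c • φ) (x, (t : S1)) = c • grad φ (x, (t : S1)) := by
  have h2 : DifferentiableAt ℝ (unroll (c • φ)) (x, t) := h.const_smul c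
  have e : fderiv ℝ (unroll (c • φ)) (x, t) = c • fderiv ℝ (unroll φ) (x, t) :=
    fderiv_const_smul h c
  rw [grad, grad, ← join_smul, dTheta_coe h2, dTheta_coe h, e, gradX_coe h2, gradX_coe h, e,
    ContinuousLinearMap.smul_comp, map_smul]
  rfl

theorem IsTest.add {ψ : E2 × S1 → ℝ} (h : IsTest Ω φ) (h' : IsTest Ω ψ) : IsTest Ω (φ + ψ) :=
  ⟨h.1.add h'.1, h.2.1.add h'.2.1, (tsupport_add φ ψ).trans (union_subset h.2.2 h'.2.2)⟩

theorem IsTest.const_smul (c : ℝ) (h : IsTest Ω φ) : IsTest Ω (c • φ) :=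
  ⟨h.1.const_smul c, h.2.1.smul_left (f := fun _ => c),
    (tsupport_smul_subset_right (fun _ => c) φ).trans h.2.2⟩

theorem IsTest.zero : IsTest Ω 0 :=
  ⟨contDiff_const, HasCompactSupport.zero, by simp [tsupport]⟩

theorem IsPlaneTest.exists_norm_le {φ : E2 → E2} (h : IsPlaneTest Ω φ) : ∃ C, ∀ x, ‖φ x‖ ≤ C :=
  h.2.1.exists_bound_of_continuous h.1.continuous

end TestFunctions

/-! ### Jensen's inequality for the energy -/

section Jensen

variable {f : ℝ → ℝ≥0∞} {Ω : Set E2}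

/-- Among the first `n` vectors `dualVec θ (ξ k)` and `0`, one with the largest inner product with
`P z`. -/
def bestVec (ξ : ℕ → (ℝ × ℝ) × ℝ) (P : Ω × S1 → E3) : ℕ → Ω × S1 → E3
  | 0 => fun _ => 0
  | n + 1 => fun z =>
    open Classical in
    if ⟪bestVec ξ P n z, P z⟫_ℝ < ⟪dualVec z.2 (ξ n), P z⟫_ℝ then dualVec z.2 (ξ n)
    else bestVec ξ P n z

variable {ξ : ℕ → (ℝ × ℝ) × ℝ} {P : Ω × S1 → E3}

open Classical in
theorem bestVec_succ (n : ℕ) (z : Ω × S1) : bestVec ξ P (n + 1) z =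
    if ⟪bestVec ξ P n z, P z⟫_ℝ < ⟪dualVec z.2 (ξ n), P z⟫_ℝ then dualVec z.2 (ξ n)
    else bestVec ξ P n z := rfl

theorem bestVec_mem (n : ℕ) (z : Ω × S1) :
    bestVec ξ P n z = 0 ∨ ∃ k < n, bestVec ξ P n z = dualVec z.2 (ξ k) := by
  induction n with
  | zero => exact Or.inl rfl
  | succ n ih =>
    rw [bestVec_succ]
    split_ifs
    · exact Or.inr ⟨n, n.lt_succ_self, rfl⟩
    · exact ih.imp_right fun ⟨k, hk, e⟩ => ⟨k, hk.trans n.lt_succ_self, e⟩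

theorem monotone_inner_bestVec (z : Ω × S1) : Monotone fun n => ⟪bestVec ξ P n z, P z⟫_ℝ := by
  refine monotone_nat_of_le_succ fun n => ?_
  rw [bestVec_succ]
  split_ifs with h
  · exact h.le
  · exact le_rfl

theorem inner_dualVec_le_bestVec (n : ℕ) (z : Ω × S1) :
    ⟪dualVec z.2 (ξ n), P z⟫_ℝ ≤ ⟪bestVec ξ P (n + 1) z, P z⟫_ℝ := by
  rw [bestVec_succ]
  split_ifs with h
  · exact le_rfl
  · exact not_lt.1 h

/-- The selection starts from the zero vector; nonnegativity lets its `lintegral` be computed as a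
pairing with `σ`. -/
theorem inner_bestVec_nonneg (n : ℕ) (z : Ω × S1) : 0 ≤ ⟪bestVec ξ P n z, P z⟫_ℝ := by
  have := monotone_inner_bestVec (ξ := ξ) (P := P) z (Nat.zero_le n)
  simpa [bestVec] using this

theorem measurable_bestVec (hP : Measurable P) (n : ℕ) : Measurable (bestVec ξ P n) := by
  induction n with
  | zero => exact measurable_const
  | succ n ih =>
    have hd : Measurable fun z : Ω × S1 => dualVec z.2 (ξ n) :=
      (continuous_dualVec.comp (continuous_snd.prodMk continuous_const)).measurable
    exact Measurable.ite (measurableSet_lt (ih.inner hP) (hd.inner hP)) hd ih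

theorem exists_norm_bestVec_le (n : ℕ) : ∃ C, ∀ z, ‖bestVec ξ P n z‖ ≤ C := by
  induction n with
  | zero => exact ⟨0, fun z => by simp [bestVec]⟩
  | succ n ih =>
    obtain ⟨C, hC⟩ := ih
    refine ⟨max (|(ξ n).1.1| + |(ξ n).2| + |(ξ n).1.2|) C, fun z => ?_⟩
    rw [bestVec_succ]
    split_ifs
    · exact (norm_dualVec_le _ _).trans (le_max_left _ _)
    · exact (hC z).trans (le_max_right _ _)

theorem ofReal_integral_le_lintegral {T : Type*} [MeasurableSpace T] {ν : Measure T} {g : T → ℝ}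
    (hg : Integrable g ν) : ENNReal.ofReal (∫ t, g t ∂ν) ≤ ∫⁻ t, ENNReal.ofReal (g t) ∂ν := by
  calc ENNReal.ofReal (∫ t, g t ∂ν) ≤ ENNReal.ofReal (∫ t, max (g t) 0 ∂ν) :=
        ENNReal.ofReal_le_ofReal (integral_mono hg hg.pos_part fun t => le_max_left _ _)
    _ = ∫⁻ t, ENNReal.ofReal (max (g t) 0) ∂ν :=
        ofReal_integral_eq_lintegral_ofReal hg.pos_part (ae_of_all _ fun t => le_max_right _ _)
    _ = ∫⁻ t, ENNReal.ofReal (g t) ∂ν := by simp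

theorem integrable_inner_of_bounded {T : Type*} [MeasurableSpace T] {ν : Measure T} {g v : T → E3}
    (hg : Measurable g) {C : ℝ} (hC : ∀ t, ‖g t‖ ≤ C) (hv : Integrable v ν) :
    Integrable (fun t => ⟪g t, v t⟫_ℝ) ν := by
  refine (hv.norm.const_mul C).mono' (hg.aestronglyMeasurable.inner hv.aestronglyMeasurable)
    (ae_of_all _ fun t => ?_)
  exact (norm_inner_le_norm _ _).trans (mul_le_mul_of_nonneg_right (hC t) (norm_nonneg _))

/-- Jensen's inequality: pushing a vector-valued density forward does not increase the energy. -/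
theorem energy_pushDensity_le (hc : ConvexOn ℝ≥0 univ f) (hl : LowerSemicontinuous f)
    {T : Type*} [MeasurableSpace T] {ν : Measure T} {π : T → Ω × S1} (hπ : Measurable π)
    {v : T → E3} (hv : Integrable v ν)
    (hray : ∀ t, ∃ r : ℝ, 0 ≤ r ∧ spat (v t) = r • dir (π t).2) :
    energy f (pushDensity ν π v) ≤ ∫⁻ t, hfun f (π t).2 (v t) ∂ν := by
  obtain ⟨ξ, hξ, hsup⟩ := exists_seq_hfun_le hc hl
  set σ := pushDensity ν π v
  have hσ := isFiniteMeasure_variation σ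
  set B := bestVec ξ (polar σ)
  have hB : ∀ n, Measurable (B n) := measurable_bestVec (measurable_polar σ)
  -- `B n` is a bounded measurable field on `Ω × S¹`, so its pairing with `σ` is an integral of `⟪B
  -- n (π t), v t⟫`. Although chosen for `polar σ`, each value of `B n` is zero or a form lying
  -- below `h` on the ray that contains `v t`.
  have hstep : ∀ n, ∫⁻ z, ENNReal.ofReal ⟪B n z, polar σ z⟫_ℝ ∂σ.variation
      ≤ ∫⁻ t, hfun f (π t).2 (v t) ∂ν := by
    intro n
    obtain ⟨C, hC⟩ := exists_norm_bestVec_le (ξ := ξ) (P := polar σ) n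
    rw [← ofReal_integral_eq_lintegral_ofReal
      (integrable_inner_of_bounded (hB n) hC (integrable_polar σ))
      (ae_of_all _ fun z => inner_bestVec_nonneg n z),
      ← pair_eq_integral_polar σ (hB n) hC, pair_pushDensity hπ hv (hB n) hC]
    refine (ofReal_integral_le_lintegral (integrable_inner_of_bounded ((hB n).comp hπ)
      (fun t => hC _) hv)).trans (lintegral_mono fun t => ?_)
    obtain ⟨r, hr, hvr⟩ := hray t
    rcases bestVec_mem (ξ := ξ) (P := polar σ) n (π t) with h | ⟨k, -, h⟩
    · simp only [B, Function.comp_apply, h, inner_zero_left, ENNReal.ofReal_zero, zero_le]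
    · simp only [B, Function.comp_apply, h]
      rw [inner_dualVec_ray _ _ hvr]
      exact affineMinorant_le_hfun (hξ k) hr hvr
  calc energy f σ ≤ ∫⁻ z, ⨆ n, ENNReal.ofReal ⟪B n z, polar σ z⟫_ℝ ∂σ.variation := by
        refine lintegral_mono_ae ?_
        filter_upwards [ae_polar_ne_zero σ] with z hz
        refine (hsup z.2 _ hz).trans (iSup_le fun n => ?_)
        exact (ENNReal.ofReal_le_ofReal (inner_dualVec_le_bestVec n z)).trans
          (le_iSup (fun n => ENNReal.ofReal ⟪B n z, polar σ z⟫_ℝ) (n + 1))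
    _ = ⨆ n, ∫⁻ z, ENNReal.ofReal ⟪B n z, polar σ z⟫_ℝ ∂σ.variation :=
        lintegral_iSup (fun n => ((hB n).inner (measurable_polar σ)).ennreal_ofReal)
          fun m n hmn z => ENNReal.ofReal_le_ofReal (monotone_inner_bestVec z hmn)
    _ ≤ _ := iSup_le hstep

end Jensen

/-! ### Comparison with the lifted relaxation -/

section LiftedRelaxation

variable {f : ℝ → ℝ≥0∞} {Ω : Set E2} {u : E2 → ℝ}

theorem hfun_join_dir (θ : S1) (κ : ℝ) : hfun f θ (join (dir θ) κ) = f κ := by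
  have h0 : dir θ ≠ 0 := fun h => by simpa [h] using norm_dir θ
  rw [hfun, spat_join, if_neg h0, if_pos ⟨1, zero_le_one, (one_smul _ _).symm⟩, norm_dir]
  simp

theorem measurable_dir : Measurable dir := continuous_dir.measurable

theorem measurable_join {X : Type*} [MeasurableSpace X] {a : X → E2} {b : X → ℝ}
    (ha : Measurable a) (hb : Measurable b) : Measurable fun x => join (a x) (b x) :=
  continuous_join.measurable.comp (ha.prodMk hb)

theorem IsTest.measurable_grad {φ : E2 × S1 → ℝ} (h : IsTest Ω φ) :
    Measurable fun z : Ω × S1 => grad φ (z.1, z.2) :=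
  h.continuous_grad.measurable.comp (by fun_prop)

theorem IsPlaneTest.measurable_join {φ : E2 → E2} (h : IsPlaneTest Ω φ) :
    Measurable fun z : Ω × S1 => join (perp (φ z.1)) 0 :=
  RotoTV.measurable_join ((perp.continuous.comp h.1.continuous).measurable.comp (by fun_prop))
    measurable_const

theorem norm_perp (v : E2) : ‖perp v‖ = ‖v‖ := by
  rw [EuclideanSpace.norm_eq, EuclideanSpace.norm_eq, Fin.sum_univ_two, Fin.sum_univ_two]
  simp [add_comm]

theorem IsPlaneTest.exists_norm_join_le {φ : E2 → E2} (h : IsPlaneTest Ω φ) :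
    ∃ C, ∀ z : Ω × S1, ‖join (perp (φ z.1)) 0‖ ≤ C := by
  obtain ⟨C, hC⟩ := h.exists_norm_le
  exact ⟨C, fun z => (norm_join_le _ _).trans (by rw [norm_perp, abs_zero, add_zero]; exact hC _)⟩

/-- Forgetting the curvature pushes `(dir θ, κ) μ` to an admissible `σ`, which averages `κ` over
each fibre; Jensen's inequality controls the averaging. -/
theorem F_le_liftedRelaxation (hc : ConvexOn ℝ≥0 univ f) (hl : LowerSemicontinuous f) :
    F f Ω u ≤ liftedRelaxation f Ω u := by
  refine le_iInf₂ fun μ hμ => ?_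
  have := hμ.finite
  let π : Ω × S1 × ℝ → Ω × S1 := fun z => (z.1, z.2.1)
  let v : Ω × S1 × ℝ → E3 := fun z => join (dir z.2.1) z.2.2
  have hπ : Measurable π := by fun_prop
  have hvm : Measurable v := measurable_join (measurable_dir.comp (by fun_prop)) (by fun_prop)
  have hv : Integrable v μ := by
    refine ((integrable_const (1 : ℝ)).add hμ.integrable.norm).mono' hvm.aestronglyMeasurable
      (ae_of_all _ fun z => ?_)
    refine (norm_join_le _ _).trans (le_of_eq ?_)
    rw [norm_dir]; rfl
  refine (iInf₂_le (pushDensity μ π v) ?_).trans ((iInf_le _ ?_).trans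
    ((energy_pushDensity_le hc hl hπ hv fun z => ?_).trans (le_of_eq ?_)))
  · intro φ hφ
    obtain ⟨C, hC⟩ := hφ.exists_norm_grad_le
    refine (pair_pushDensity hπ hv hφ.measurable_grad (fun z => hC _)).trans ?_
    rw [← hμ.consistent φ hφ]
    refine integral_congr_ae (ae_of_all _ fun z => ?_)
    simp only [grad, inner_join, π, v, spat_join, join_two_coord]
    rw [mul_comm]
  · intro φ hφ
    obtain ⟨C, hC⟩ := hφ.exists_norm_join_le
    rw [pair_pushDensity hπ hv hφ.measurable_join hC, ← hμ.compatible φ hφ]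
    refine integral_congr_ae (ae_of_all _ fun z => ?_)
    simp [inner_join, π, v]
  · exact ⟨1, zero_le_one, by simp [v, π]⟩
  · exact lintegral_congr fun z => hfun_join_dir _ _

/-- For a superlinear integrand, a measure of finite energy is carried by the vectors with a
positive component along `dir θ` and no component across it. -/
theorem ae_polar_ray (hrec : ∀ t : ℝ, t ≠ 0 → recession f t = ⊤)
    {σ : VectorMeasure (Ω × S1) E3} (hσ : energy f σ ≠ ⊤) :
    ∀ᵐ z ∂σ.variation, 0 < ⟪dir z.2, spat (polar σ z)⟫_ℝ ∧
      spat (polar σ z) = ⟪dir z.2, spat (polar σ z)⟫_ℝ • dir z.2 := by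
  have hm : Measurable fun z => spat (polar σ z) :=
    continuous_spat.measurable.comp (measurable_polar σ)
  have hdm : Measurable fun z : Ω × S1 => dir z.2 := measurable_dir.comp measurable_snd
  let G : Set (Ω × S1) := {z | 0 < ⟪dir z.2, spat (polar σ z)⟫_ℝ ∧
      spat (polar σ z) = ⟪dir z.2, spat (polar σ z)⟫_ℝ • dir z.2}
  have hr : Measurable fun z : Ω × S1 => ⟪dir z.2, spat (polar σ z)⟫_ℝ := hdm.inner hm
  have hG : MeasurableSet G := (measurableSet_lt measurable_const hr).inter
    (measurableSet_eq_fun hm (Measurable.smul hr hdm))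
  -- At a nonzero vector outside `G` the integrand is infinite; for vectors with zero spatial part
  -- this is superlinearity.
  have hle : ∫⁻ z, Gᶜ.indicator (fun _ => ⊤) z ∂σ.variation ≤ energy f σ := by
    refine lintegral_mono_ae ?_
    filter_upwards [ae_polar_ne_zero σ] with z hz
    by_cases hzG : z ∈ G
    · simp [hzG]
    rw [indicator_of_mem hzG, hfun]
    split_ifs with h0 hr
    · rw [hrec]
      intro h2
      refine hz ?_
      ext i; fin_cases i
      · exact congrArg (fun v : E2 => v 0) h0
      · exact congrArg (fun v : E2 => v 1) h0
      · exact h2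
    · obtain ⟨r, hr, hzr⟩ := hr
      refine absurd ?_ hzG
      have e : ⟪dir z.2, spat (polar σ z)⟫_ℝ = r := by
        rw [hzr, real_inner_smul_right, inner_dir_self, mul_one]
      refine ⟨?_, ?_⟩
      · rw [e]
        refine hr.lt_of_ne fun h => h0 ?_
        rw [hzr, ← h, zero_smul]
      · rw [e]; exact hzr
    · exact le_rfl
  rw [lintegral_indicator_const hG.compl] at hle
  have h0 : σ.variation Gᶜ = 0 := by
    by_contra h
    rw [ENNReal.top_mul h] at hle
    exact hσ (top_le_iff.1 hle)
  exact h0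

/-- Here `σ^x = r dir θ |σ|` with `r > 0`, so `r |σ|` is a measure on curves of unit speed and `p^θ
/ r` is their curvature. Multiplying by `r` restores each integrand, including `r f(p^θ / r) = h`.
-/
theorem liftedRelaxation_le_F (hl : LowerSemicontinuous f)
    (hrec : ∀ t : ℝ, t ≠ 0 → recession f t = ⊤) : liftedRelaxation f Ω u ≤ F f Ω u := by
  refine le_iInf fun σ => le_iInf₂ fun hdiv hproj => ?_
  by_cases hfin : energy f σ = ⊤
  · rw [hfin]; exact le_top
  have hray := ae_polar_ray hrec hfin
  have := isFiniteMeasure_variation σ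
  set P := polar σ
  have hPm : Measurable P := measurable_polar σ
  have hPi : Integrable P σ.variation := integrable_polar σ
  let r : Ω × S1 → ℝ := fun z => ⟪dir z.2, spat (P z)⟫_ℝ
  have hrm : Measurable r :=
    (measurable_dir.comp measurable_snd).inner (continuous_spat.measurable.comp hPm)
  have hcoord : Measurable fun z => P z 2 :=
    (EuclideanSpace.proj (𝕜 := ℝ) (2 : Fin 3)).continuous.measurable.comp hPm
  let k : Ω × S1 → Ω × S1 × ℝ := fun z => (z.1, z.2, P z 2 / r z)
  have hk : Measurable k :=
    measurable_fst.prodMk (measurable_snd.prodMk (hcoord.div hrm))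
  let ν := σ.variation.withDensity fun z => ENNReal.ofReal (r z)
  have hrfin : ∀ᵐ z ∂σ.variation, ENNReal.ofReal (r z) < ⊤ :=
    ae_of_all _ fun _ => ENNReal.ofReal_lt_top
  have hinteg : ∀ g : Ω × S1 → ℝ, ∫ z, g z ∂ν = ∫ z, r z * g z ∂σ.variation := by
    intro g
    rw [integral_withDensity_eq_integral_toReal_smul hrm.ennreal_ofReal hrfin]
    refine integral_congr_ae ?_
    filter_upwards [hray] with z hz
    rw [ENNReal.toReal_ofReal hz.1.le, smul_eq_mul]
  have hν : IsFiniteMeasure ν := by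
    refine isFiniteMeasure_withDensity (ne_of_lt ?_)
    refine lt_of_le_of_lt (lintegral_mono fun z => ?_) hPi.2
    rw [← ofReal_norm]
    refine ENNReal.ofReal_le_ofReal ((real_inner_le_norm _ _).trans ?_)
    rw [norm_dir, one_mul]
    exact norm_spat_le _
  have hmul : ∀ z, 0 < r z → r z * (P z 2 / r z) = P z 2 := fun z hz => by field_simp
  have hlift : IsLifting u (ν.map k) := by
    refine ⟨inferInstance, ?_, ?_, ?_⟩
    · rw [integrable_map_measure (by fun_prop) hk.aemeasurable]
      rw [integrable_withDensity_iff_integrable_smul' hrm.ennreal_ofReal hrfin]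
      refine ((EuclideanSpace.proj (𝕜 := ℝ) (2 : Fin 3) : E3 →L[ℝ] ℝ).integrable_comp hPi).congr ?_
      filter_upwards [hray] with z hz
      rw [ENNReal.toReal_ofReal hz.1.le, smul_eq_mul]
      exact (hmul z hz.1).symm
    · intro φ hφ
      obtain ⟨C, hC⟩ := hφ.exists_norm_grad_le
      have h1 : pair (fun z : Ω × S1 => grad φ (z.1, z.2)) σ = 0 := hdiv φ hφ
      rw [pair_eq_integral_polar σ hφ.measurable_grad (fun z => hC _)] at h1
      have hg : Measurable fun z : Ω × S1 × ℝ => grad φ (z.1, z.2.1) :=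
        hφ.continuous_grad.measurable.comp (by fun_prop)
      have hg' : (fun z : Ω × S1 × ℝ => ⟪gradX φ (z.1, z.2.1), dir z.2.1⟫_ℝ
          + z.2.2 * dTheta φ (z.1, z.2.1))
          = fun z => ⟪grad φ (z.1, z.2.1), join (dir z.2.1) z.2.2⟫_ℝ := by
        ext z
        rw [grad, inner_join, spat_join, join_two_coord, mul_comm]
      have hm' : Measurable fun z : Ω × S1 × ℝ =>
          ⟪grad φ (z.1, z.2.1), join (dir z.2.1) z.2.2⟫_ℝ :=
        hg.inner (measurable_join (measurable_dir.comp (by fun_prop)) (by fun_prop))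
      rw [hg', integral_map hk.aemeasurable hm'.aestronglyMeasurable, hinteg, ← h1]
      refine integral_congr_ae ?_
      filter_upwards [hray] with z hz
      simp only [k]
      rw [← real_inner_smul_right, ← join_smul, hmul z hz.1]
      congr 1
      rw [show r z • dir z.2 = spat (P z) from hz.2.symm]
      ext i; fin_cases i <;> rfl
    · intro φ hφ
      obtain ⟨C, hC⟩ := hφ.exists_norm_join_le
      have hm' : Measurable fun z : Ω × S1 × ℝ => ⟪perp (φ z.1), dir z.2.1⟫_ℝ :=
        ((perp.continuous.comp hφ.1.continuous).measurable.comp (by fun_prop)).inner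
          (measurable_dir.comp (by fun_prop))
      rw [← hproj φ hφ, pair_eq_integral_polar σ hφ.measurable_join hC,
        integral_map hk.aemeasurable hm'.aestronglyMeasurable, hinteg]
      refine integral_congr_ae ?_
      filter_upwards [hray] with z hz
      simp only [k]
      rw [← real_inner_smul_right, show r z • dir z.2 = spat (P z) from hz.2.symm, inner_join,
        zero_mul, add_zero]
  refine (iInf₂_le (ν.map k) hlift).trans ?_
  rw [lintegral_map (f := fun z : Ω × S1 × ℝ => f z.2.2) (hl.measurable.comp (by fun_prop)) hk,
    lintegral_withDensity_eq_lintegral_mul _ hrm.ennreal_ofReal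
      (g := fun z => f (P z 2 / r z)) (hl.measurable.comp (hcoord.div hrm))]
  refine le_of_eq (lintegral_congr_ae ?_)
  filter_upwards [hray] with z hz
  have hn : ‖spat (P z)‖ = r z := by
    conv_lhs => rw [hz.2]
    rw [norm_smul, norm_dir, mul_one, Real.norm_of_nonneg hz.1.le]
  have h0 : spat (P z) ≠ 0 := norm_ne_zero_iff.1 (by rw [hn]; exact hz.1.ne')
  rw [hfun, if_neg h0, if_pos ⟨_, hz.1.le, hz.2⟩, hn]
  rfl

theorem F_eq_liftedRelaxation (hc : ConvexOn ℝ≥0 univ f) (hl : LowerSemicontinuous f)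
    (hrec : ∀ t : ℝ, t ≠ 0 → recession f t = ⊤) : F f Ω u = liftedRelaxation f Ω u :=
  (F_le_liftedRelaxation hc hl).antisymm (liftedRelaxation_le_F hl hrec)

end LiftedRelaxation

/-! ### Cutoff functions -/

section Cutoff

/-- A smooth cutoff function of the compact set `K` in the open set `Ω`. -/
theorem exists_cutoff {Ω K : Set E2} (hΩ : IsOpen Ω) (hK : IsCompact K) (hKΩ : K ⊆ Ω) :
    ∃ χ : E2 → ℝ, ContDiff ℝ 2 χ ∧ HasCompactSupport χ ∧ tsupport χ ⊆ Ω ∧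
      (∀ x ∈ K, ∀ᶠ y in 𝓝 x, χ y = 1) ∧ ∀ x, χ x ∈ Icc (0 : ℝ) 1 := by
  obtain ⟨L, hL, hKL, hLΩ⟩ := exists_compact_between hK hΩ hKΩ
  obtain ⟨χ, h1, h0, h01⟩ := exists_contMDiffMap_one_nhds_of_subset_interior
    (n := 2) (modelWithCornersSelf ℝ E2) hK.isClosed hKL
  have hs : tsupport χ ⊆ L := closure_minimal
    (fun x hx => by_contra fun h => hx (h0 x h)) hL.isClosed
  exact ⟨χ, χ.contMDiff.contDiff, HasCompactSupport.of_support_subset_isCompact hL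
    ((subset_tsupport _).trans hs), hs.trans hLΩ,
    fun x hx => (eventually_nhdsSet_iff_forall.1 h1) x hx, h01⟩

end Cutoff

/-! ### Testing the projection condition with continuous fields -/

section Plane

variable {Ω : Set E2} {u : E2 → ℝ}

/-- Embedding the plane in space reduces this to the polar decomposition already available there. -/
theorem exists_density_plane {X : Type*} [MeasurableSpace X] (D : VectorMeasure X E2) :
    ∃ (ν : Measure X) (g : X → E2), IsFiniteMeasure ν ∧ Integrable g ν ∧
      ∀ A, MeasurableSet A → D A = ∫ x in A, g x ∂ν := by
  let J : E2 →L[ℝ] E3 := LinearMap.toContinuousLinearMap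
    { toFun := fun v => join v 0
      map_add' := fun v w => by rw [← join_add, add_zero]
      map_smul' := fun c v => by
        rw [RingHom.id_apply, ← join_smul, mul_zero] }
  let S : E3 →L[ℝ] E2 := LinearMap.toContinuousLinearMap
    { toFun := spat
      map_add' := fun v w => by ext i; fin_cases i <;> rfl
      map_smul' := fun c v => by ext i; fin_cases i <;> rfl }
  let σ : VectorMeasure X E3 := D.mapRange J.toLinearMap.toAddMonoidHom J.continuous
  have := isFiniteMeasure_variation σ
  refine ⟨σ.variation, fun x => S (polar σ x), this, S.integrable_comp (integrable_polar σ),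
    fun A hA => ?_⟩
  rw [S.integral_comp_comm (integrable_polar σ).integrableOn, setIntegral_polar σ hA]
  change D A = spat (join (D A) 0)
  rw [spat_join]

theorem perp_perp (v : E2) : perp (perp v) = -v := by
  ext i; fin_cases i <;> rfl

theorem inner_perp_perp (v w : E2) : ⟪perp v, perp w⟫_ℝ = ⟪v, w⟫_ℝ := by
  simp [inner_plane]; ring

theorem pair_perp_perpMeasure (D : VectorMeasure Ω E2) {φ : Ω → E2} (hφ : Measurable φ) {C : ℝ}
    (hC : ∀ x, ‖φ x‖ ≤ C) : pair (fun x => perp (φ x)) (perpMeasure D) = pair φ D := by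
  obtain ⟨ν, g, hν, hg, hD⟩ := exists_density_plane D
  have h1 : ∀ A, MeasurableSet A → perpMeasure D A = ∫ x in id ⁻¹' A, perp (g x) ∂ν := by
    intro A hA
    rw [preimage_id, perp.integral_comp_comm hg.integrableOn, ← hD A hA]
    rfl
  rw [pair_eq_integral _ measurable_id (perp.integrable_comp hg) h1
    (show Measurable fun x => perp (φ x) from perp.continuous.measurable.comp hφ)
    (C := C) (fun x => by rw [norm_perp]; exact hC x),
    pair_eq_integral _ measurable_id hg hD hφ hC]
  simp only [id, inner_perp_perp]

theorem IsPlaneTest.perp {φ : E2 → E2} (h : IsPlaneTest Ω φ) :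
    IsPlaneTest Ω fun x => perp (φ x) := by
  refine ⟨RotoTV.perp.contDiff.comp h.1, h.2.1.comp_left (map_zero _), ?_⟩
  exact (closure_mono (Function.support_comp_subset (map_zero _) φ)).trans h.2.2

theorem IsPlaneTest.neg {φ : E2 → E2} (h : IsPlaneTest Ω φ) : IsPlaneTest Ω fun x => -φ x := by
  refine ⟨h.1.neg, h.2.1.comp_left (g := fun v : E2 => -v) neg_zero, ?_⟩
  exact (closure_mono (Function.support_comp_subset (g := fun v : E2 => -v) neg_zero φ)).trans h.2.2

/-- Both conditions are tested with `φ = -ψ^⊥`, for which `φ^⊥ = ψ`. -/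
theorem pair_perpMeasure_of_isPlaneTest {Du : VectorMeasure Ω E2} (hDu : IsDerivMeasure Ω u Du)
    {σ : VectorMeasure (Ω × S1) E3} (hσ : Projects u σ) {ψ : E2 → E2} (hψ : IsPlaneTest Ω ψ) :
    pair (fun x : Ω => ψ x) (perpMeasure Du)
      = pair (fun z : Ω × S1 => join (ψ z.1) 0) σ := by
  have hφ := hψ.perp.neg
  obtain ⟨C, hC⟩ := hφ.exists_norm_le
  have e : ∀ x, perp (-perp (ψ x)) = ψ x := fun x => by rw [map_neg, perp_perp, neg_neg]
  have h1 := pair_perp_perpMeasure Du (φ := fun x : Ω => -perp (ψ x))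
    (hφ.1.continuous.measurable.comp measurable_subtype_coe) fun x : Ω => hC x
  have h2 := hσ _ hφ
  simp_rw [e] at h1 h2
  exact h1.trans ((hDu _ hφ).trans h2.symm)

/-- Continuous compactly supported fields are uniform limits of `C^1` ones. -/
theorem exists_isPlaneTest_norm_sub_le (hΩ : IsOpen Ω) {ψ : E2 → E2} (hψ : Continuous ψ)
    (hc : HasCompactSupport ψ) (hs : tsupport ψ ⊆ Ω) {ε : ℝ} (hε : 0 < ε) :
    ∃ φ, IsPlaneTest Ω φ ∧ ∀ x, ‖φ x - ψ x‖ ≤ ε := by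
  obtain ⟨χ, h1, h2, h3, h4, h5⟩ := exists_cutoff hΩ hc hs
  obtain ⟨g, hg, hgψ⟩ := (hc.uniformContinuous_of_continuous hψ).exists_contDiff_dist_le hε
  refine ⟨fun x => χ x • g x, ⟨(h1.of_le (by norm_num)).smul (hg.of_le (by simp)),
    h2.smul_right, (tsupport_smul_subset_left χ g).trans h3⟩, fun x => ?_⟩
  have e : ψ x = χ x • ψ x := by
    by_cases hx : x ∈ tsupport ψ
    · rw [(h4 x hx).self_of_nhds, one_smul]
    · rw [image_eq_zero_of_notMem_tsupport hx, smul_zero]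
  have e' : χ x • g x - ψ x = χ x • (g x - ψ x) := by rw [smul_sub, ← e]
  simp only [e', norm_smul]
  rw [Real.norm_of_nonneg (h5 x).1]
  have := hgψ x
  rw [dist_eq_norm] at this
  exact (mul_le_of_le_one_left (norm_nonneg _) (h5 x).2).trans this.le

/-- If `σ` projects to `Du^⊥`, then it does so when tested with continuous fields. -/
theorem pair_perpMeasure_eq (hΩ : IsOpen Ω) {Du : VectorMeasure Ω E2}
    (hDu : IsDerivMeasure Ω u Du) {σ : VectorMeasure (Ω × S1) E3} (hσ : Projects u σ)
    {ψ : E2 → E2} (hψ : Continuous ψ) (hc : HasCompactSupport ψ) (hs : tsupport ψ ⊆ Ω) :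
    pair (fun x : Ω => ψ x) (perpMeasure Du)
      = pair (fun z : Ω × S1 => join (ψ z.1) 0) σ := by
  have := isFiniteMeasure_variation σ
  have := isFiniteMeasure_variation (perpMeasure Du)
  have hex : ∀ n : ℕ, ∃ φ, IsPlaneTest Ω φ ∧ ∀ x, ‖φ x - ψ x‖ ≤ 1 / ((n : ℝ) + 1) := fun n =>
    exists_isPlaneTest_norm_sub_le hΩ hψ hc hs (by positivity)
  choose φ hφ hφψ using hex
  obtain ⟨C, hC⟩ := hc.exists_bound_of_continuous hψ
  have hlim : ∀ x, Tendsto (fun n => φ n x) atTop (𝓝 (ψ x)) := fun x => by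
    rw [tendsto_iff_norm_sub_tendsto_zero]
    exact squeeze_zero (fun _ => norm_nonneg _) (fun n => hφψ n x)
      tendsto_one_div_add_atTop_nhds_zero_nat
  have hbd : ∀ n x, ‖φ n x‖ ≤ C + 1 := fun n x => by
    have h1 : (1 : ℝ) / ((n : ℝ) + 1) ≤ 1 := by
      rw [div_le_one (by positivity)]; linarith [n.cast_nonneg (α := ℝ)]
    calc ‖φ n x‖ = ‖ψ x + (φ n x - ψ x)‖ := by rw [add_sub_cancel]
      _ ≤ C + 1 := (norm_add_le _ _).trans (add_le_add (hC x) ((hφψ n x).trans h1))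
  have l1 : Tendsto (fun n => pair (fun x : Ω => φ n x) (perpMeasure Du)) atTop
      (𝓝 (pair (fun x : Ω => ψ x) (perpMeasure Du))) :=
    VectorMeasure.tendsto_integral_of_dominated_convergence (fun _ => C + 1)
      (fun n => ((hφ n).1.continuous.comp continuous_subtype_val).aestronglyMeasurable)
      (integrable_const _) (fun n => ae_of_all _ fun x => hbd n x) (ae_of_all _ fun x => hlim x)
  have l2 : Tendsto (fun n => pair (fun z : Ω × S1 => join (φ n z.1) 0) σ) atTop
      (𝓝 (pair (fun z : Ω × S1 => join (ψ z.1) 0) σ)) := by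
    refine VectorMeasure.tendsto_integral_of_dominated_convergence (fun _ => C + 1)
      (fun n => ?_) (integrable_const _) (fun n => ae_of_all _ fun z => ?_)
      (ae_of_all _ fun z => ?_)
    · exact (measurable_join ((hφ n).1.continuous.measurable.comp (by fun_prop))
        measurable_const).aestronglyMeasurable
    · refine (norm_join_le _ _).trans ?_
      rw [abs_zero, add_zero]; exact hbd n _
    · exact (continuous_join.tendsto _).comp ((hlim _).prodMk_nhds tendsto_const_nhds)
  simp_rw [fun n => pair_perpMeasure_of_isPlaneTest hDu hσ (hφ n)] at l1
  exact tendsto_nhds_unique l1 l2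

end Plane

/-! ### Weak duality and the larger class of test functions -/

section WeakDuality

/-- Positivity of the period gives compactness of the circle. -/
instance fact_two_pi_pos : Fact (0 < 2 * Real.pi) := ⟨Real.two_pi_pos⟩

variable {Ω : Set E2} {u : E2 → ℝ} {f : ℝ → ℝ≥0∞}

/-- For `χ` smooth and `c` with gradient zero wherever that of `χ` is not, the field `c ∇χ` rotated
by a right angle has no divergence. -/
theorem planeDiv_neg_perp_smul_gradient {χ c : E2 → ℝ} {x : E2} (hχ : ContDiffAt ℝ 2 χ x)
    (hc : HasFDerivAt c (0 : E2 →L[ℝ] ℝ) x) :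
    planeDiv (fun y => -perp (c y • gradient χ y)) x = 0 := by
  let e : Fin 2 → E2 := fun i => EuclideanSpace.single i 1
  let L : (E2 →L[ℝ] ℝ) →L[ℝ] E2 := LinearMap.toContinuousLinearMap
    { toFun := fun ℓ => !₂[ℓ (e 0), ℓ (e 1)]
      map_add' := fun v w => by ext i; fin_cases i <;> rfl
      map_smul' := fun c v => by ext i; fin_cases i <;> rfl }
  have hL : gradient χ = fun y => L (fderiv ℝ χ y) := by
    ext y i
    have h := InnerProductSpace.toDual_symm_apply (𝕜 := ℝ) (x := e i) (y := fderiv ℝ χ y)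
    rw [EuclideanSpace.inner_single_right] at h
    simp only [one_mul, conj_trivial] at h
    refine h.trans ?_
    fin_cases i <;> rfl
  have hG : HasFDerivAt (gradient χ) (L.comp (fderiv ℝ (fderiv ℝ χ) x)) x := by
    rw [hL]
    exact L.hasFDerivAt.comp x
      ((hχ.fderiv_right (m := 1) (by norm_num)).differentiableAt one_ne_zero).hasFDerivAt
  have h2 := ((perp.hasFDerivAt.comp x (hc.smul hG)).neg).fderiv
  change fderiv ℝ (fun y => -perp (c y • gradient χ y)) x = _ at h2
  have hsymm : fderiv ℝ (fderiv ℝ χ) x (e 0) (e 1) = fderiv ℝ (fderiv ℝ χ) x (e 1) (e 0) :=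
    hχ.isSymmSndFDerivAt (by simp) (e 0) (e 1)
  have h3 : ∀ v : E2, fderiv ℝ (fun y => -perp (c y • gradient χ y)) x v
      = -perp (c x • L (fderiv ℝ (fderiv ℝ χ) x v)) := fun v => by
    rw [h2]; simp
  rw [planeDiv, Fin.sum_univ_two, h3, h3]
  change -(c x * fderiv ℝ (fderiv ℝ χ) x (e 0) (e 1))
    + -(-(c x * fderiv ℝ (fderiv ℝ χ) x (e 1) (e 0))) = 0
  rw [hsymm]
  ring

theorem pair_grad_add_join (σ : VectorMeasure (Ω × S1) E3) {g g' : Ω × S1 → E3}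
    (hg : Measurable g) {C : ℝ} (hC : ∀ z, ‖g z‖ ≤ C) (hg' : Measurable g') {C' : ℝ}
    (hC' : ∀ z, ‖g' z‖ ≤ C') : pair (fun z => g z + g' z) σ = pair g σ + pair g' σ := by
  rw [pair_eq_integral_polar σ hg hC, pair_eq_integral_polar σ hg' hC',
    pair_eq_integral_polar σ (show Measurable fun z => g z + g' z from hg.add hg') (C := C + C')
      (fun z => (norm_add_le _ _).trans (add_le_add (hC z) (hC' z))),
    ← integral_add (integrable_inner_of_bounded hg hC (integrable_polar σ))
      (integrable_inner_of_bounded hg' hC' (integrable_polar σ))]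
  simp only [inner_add_left]

/-- The gradient of a function of the larger class is the sum of that of a test function and of a
rotated divergence-free field of the plane. -/
theorem IsTestGrad.exists_decomposition (hΩ : IsOpen Ω) {φ : E2 × S1 → ℝ} (h : IsTestGrad Ω φ) :
    ∃ (Φ : E2 × S1 → ℝ) (η : E2 → E2), IsTest Ω Φ ∧ IsPlaneTest Ω η ∧
      (∀ x ∈ Ω, planeDiv η x = 0) ∧
      ∀ x ∈ Ω, ∀ θ, grad φ (x, θ) = grad Φ (x, θ) + join (perp (η x)) 0 := by
  obtain ⟨h1, K, hK, hKΩ, hKφ⟩ := h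
  obtain ⟨χ, hχ, hχc, hχs, hχ1, -⟩ := exists_cutoff hΩ hK hKΩ
  have hφ : ∀ x ∈ Ω, ∀ t : ℝ, ContDiffAt ℝ 1 (unroll φ) (x, t) := fun x hx t =>
    h1.contDiffAt ((hΩ.prod isOpen_univ).mem_nhds ⟨hx, mem_univ t⟩)
  have hφd : ∀ x ∈ Ω, ∀ t : ℝ, DifferentiableAt ℝ (unroll φ) (x, t) := fun x hx t =>
    (hφ x hx t).differentiableAt one_ne_zero
  let X : E2 × S1 → ℝ := fun z => χ z.1
  have hX : ContDiff ℝ 1 (unroll X) := (hχ.of_le (by norm_num)).comp contDiff_fst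
  have hgX : ∀ z, grad X z = join (gradient χ z.1) 0 := fun z => by
    rw [grad]; congr 1
    exact deriv_const (0 : ℝ) (χ z.1)
  let c : E2 → ℝ := fun x => φ (x, ((0 : ℝ) : S1))
  -- Off `K` the angular derivative vanishes on the whole circle over `x`, so `φ` depends on `x`
  -- alone.
  have hcφ : ∀ x ∈ Ω \ K, ∀ θ, φ (x, θ) = c x := by
    intro x hx θ
    obtain ⟨t, rfl⟩ := QuotientAddGroup.mk_surjective θ
    have hd : ∀ s : ℝ, HasDerivAt (fun s => unroll φ (x, s)) 0 s := fun s => by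
      have e := (hKφ x hx (s : S1)).2
      rw [dTheta_coe (hφd x hx.1 s)] at e
      rw [← e]
      exact (hφd x hx.1 s).hasFDerivAt.comp_hasDerivAt s
        ((hasDerivAt_const s x).prodMk (hasDerivAt_id s))
    exact is_const_of_deriv_eq_zero (fun s => (hd s).differentiableAt) (fun s => (hd s).deriv) t 0
  have hcd : ∀ x ∈ Ω \ K, HasFDerivAt c (0 : E2 →L[ℝ] ℝ) x := by
    intro x hx
    have e := (hKφ x hx ((0 : ℝ) : S1)).1
    have hg := hasGradientAt_unroll (hφd x hx.1 0)
    rw [← gradX_coe (hφd x hx.1 0), e] at hg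
    have := hg.hasFDerivAt
    rwa [map_zero] at this
  have hgz : ∀ x ∈ K, gradient χ =ᶠ[𝓝 x] fun _ => 0 := fun x hx => by
    filter_upwards [(hχ1 x hx).eventually_nhds] with y hy
    have : χ =ᶠ[𝓝 y] fun _ => 1 := hy
    rw [this.gradient_eq]; exact gradient_fun_const _ _
  let G : E2 → E2 := fun x => c x • gradient χ x
  have hgs : Function.support (gradient χ) ⊆ tsupport χ := fun x hx => by
    by_contra hn
    refine hx ?_
    have : χ =ᶠ[𝓝 x] fun _ => 0 := notMem_tsupport_iff_eventuallyEq.1 hn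
    rw [this.gradient_eq]; exact gradient_fun_const _ _
  -- Nothing is known about `c` outside `Ω`; the support of `G` stays inside `Ω`, which makes `G` a
  -- global `C^1` field.
  have hGs : tsupport G ⊆ tsupport χ :=
    closure_minimal ((Function.support_smul_subset_right c (gradient χ)).trans hgs)
      (isClosed_tsupport _)
  have hgC : ContDiff ℝ 1 (gradient χ) :=
    (InnerProductSpace.toDual ℝ E2).symm.contDiff.comp (hχ.fderiv_right (m := 1) (by norm_num))
  have hGp : IsPlaneTest Ω G := by
    refine ⟨contDiff_iff_contDiffAt.2 fun x => ?_, hχc.of_isClosed_subset (isClosed_tsupport _) hGs,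
      hGs.trans hχs⟩
    by_cases hx : x ∈ tsupport χ
    · have hc1 : ContDiffAt ℝ 1 c x :=
        ContDiffAt.comp (g := unroll φ) (f := fun y : E2 => (y, (0 : ℝ))) x
          (hφ x (hχs hx) 0) (contDiffAt_id.prodMk contDiffAt_const)
      exact hc1.smul hgC.contDiffAt
    · have : G =ᶠ[𝓝 x] fun _ => 0 :=
        notMem_tsupport_iff_eventuallyEq.1 fun h => hx (hGs h)
      exact contDiffAt_const.congr_of_eventuallyEq this
  -- From `φ = χ φ + (1 - χ) φ`: the second term vanishes near `K`, and off `K` its gradient is `-c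
  -- ∇χ = -G = (G^⊥)^⊥`, since `∇c = 0` there.
  refine ⟨X * φ, fun x => perp (G x), ⟨?_, ?_, ?_⟩, hGp.perp, fun x hx => ?_, fun x hx θ => ?_⟩
  · refine contDiff_iff_contDiffAt.2 fun ⟨x, t⟩ => ?_
    by_cases hx : x ∈ tsupport χ
    · exact hX.contDiffAt.mul (hφ x (hχs hx) t)
    · have h0 : χ =ᶠ[𝓝 x] fun _ => 0 := notMem_tsupport_iff_eventuallyEq.1 hx
      have : unroll (X * φ) =ᶠ[𝓝 (x, t)] fun _ => 0 := by
        filter_upwards [continuous_fst.continuousAt.eventually h0] with q hq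
        simp only [unroll, Pi.mul_apply, X]
        rw [hq, zero_mul]
      exact contDiffAt_const.congr_of_eventuallyEq this
  · refine HasCompactSupport.of_support_subset_isCompact (hχc.prod isCompact_univ)
      fun z hz => ⟨subset_tsupport _ fun h0 => hz ?_, mem_univ _⟩
    simp only [Pi.mul_apply, X]
    rw [h0, zero_mul]
  · refine (closure_minimal (fun z hz => ?_) ((isClosed_tsupport χ).prod isClosed_univ)).trans
      (prod_mono hχs (subset_univ _))
    refine ⟨subset_tsupport _ fun h0 => hz ?_, mem_univ _⟩
    simp only [Pi.mul_apply, X]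
    rw [h0, zero_mul]
  · by_cases hxK : x ∈ K
    · have : (fun y => perp (G y)) =ᶠ[𝓝 x] fun _ => 0 := by
        filter_upwards [hgz x hxK] with y hy
        simp only [G]
        rw [hy, smul_zero, map_zero]
      simp [planeDiv, this.fderiv_eq]
    · have h0 := planeDiv_neg_perp_smul_gradient hχ.contDiffAt (hcd x ⟨hx, hxK⟩)
      have e : fderiv ℝ (fun y => -perp (c y • gradient χ y)) x
          = -fderiv ℝ (fun y => perp (G y)) x := fderiv_fun_neg
      rw [planeDiv, e] at h0
      simp only [neg_apply, PiLp.neg_apply, Finset.sum_neg_distrib,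
        neg_eq_zero] at h0
      exact h0
  · obtain ⟨t, rfl⟩ := QuotientAddGroup.mk_surjective θ
    have e := grad_mul (hX.differentiable one_ne_zero (x, t)) (hφd x hx t)
    change grad φ (x, (t : S1)) = grad (X * φ) (x, (t : S1)) + _
    rw [e, hgX, perp_perp]
    by_cases hxK : x ∈ K
    · have e1 : X (x, (t : S1)) = 1 := (hχ1 x hxK).self_of_nhds
      have e2 : gradient χ x = 0 := (hgz x hxK).self_of_nhds
      have e3 : join (0 : E2) 0 = 0 := by ext i; fin_cases i <;> rfl
      simp only [G]
      rw [e1, one_smul, e2, smul_zero, neg_zero, e3, smul_zero, add_zero, add_zero]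
    · have e1 : grad φ (x, (t : S1)) = 0 := by
        rw [grad, (hKφ x ⟨hx, hxK⟩ t).1, (hKφ x ⟨hx, hxK⟩ t).2]
        ext i; fin_cases i <;> rfl
      rw [e1, smul_zero, zero_add, hcφ x ⟨hx, hxK⟩, ← join_smul, ← join_add]
      simp only [G]
      rw [mul_zero, add_zero, add_neg_cancel]
      ext i; fin_cases i <;> rfl

/-- `DivFree` does not apply to `φ`, which need not have compact support. It kills the test part of
the decomposition, and `Projects` turns the rest into `-∫ u div η = 0`. -/
theorem IsTestGrad.pair_grad_eq_zero (hΩ : IsOpen Ω) {φ : E2 × S1 → ℝ} (h : IsTestGrad Ω φ)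
    {σ : VectorMeasure (Ω × S1) E3} (hdiv : DivFree σ) (hproj : Projects u σ) :
    (Measurable fun z : Ω × S1 => grad φ (z.1, z.2)) ∧
      (∃ C, ∀ z : Ω × S1, ‖grad φ (z.1, z.2)‖ ≤ C) ∧
      pair (fun z : Ω × S1 => grad φ (z.1, z.2)) σ = 0 := by
  obtain ⟨Φ, η, hΦ, hη, hdη, he⟩ := h.exists_decomposition hΩ
  have e : (fun z : Ω × S1 => grad φ (z.1, z.2))
      = fun z : Ω × S1 => grad Φ (z.1, z.2) + join (perp (η z.1)) 0 :=
    funext fun z => he z.1 z.1.2 z.2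
  obtain ⟨C, hC⟩ := hΦ.exists_norm_grad_le
  obtain ⟨C', hC'⟩ := hη.exists_norm_join_le
  rw [e]
  refine ⟨hΦ.measurable_grad.add hη.measurable_join, ⟨C + C', fun z => ?_⟩, ?_⟩
  · have := congrFun e z
    rw [this]
    exact (norm_add_le _ _).trans (add_le_add (hC _) (hC' _))
  · rw [pair_grad_add_join σ hΦ.measurable_grad (fun z => hC _) hη.measurable_join hC',
      hproj η hη, show pair (fun z : Ω × S1 => grad Φ (z.1, z.2)) σ = 0 from hdiv Φ hΦ, zero_add,
      neg_eq_zero]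
    have hz : ∀ x ∈ Ω, u x * planeDiv η x = 0 := fun x hx => by rw [hdη x hx, mul_zero]
    rw [setIntegral_congr_fun hΩ.measurableSet (g := fun _ => (0 : ℝ)) hz]
    simp

theorem IsTest.isTestGrad {φ : E2 × S1 → ℝ} (h : IsTest Ω φ) : IsTestGrad Ω φ := by
  refine ⟨h.1.contDiffOn, Prod.fst '' tsupport φ, h.2.1.image continuous_fst, ?_, ?_⟩
  · rintro _ ⟨z, hz, rfl⟩
    exact (h.2.2 hz).1
  · intro x hx θ
    have h0 : grad φ (x, θ) = 0 := by
      by_contra hn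
      exact hx.2 ⟨(x, θ), support_grad_subset hn, rfl⟩
    have h1 : spat (grad φ (x, θ)) = 0 := by rw [h0]; ext i; fin_cases i <;> rfl
    have h2 : grad φ (x, θ) 2 = 0 := by rw [h0]; rfl
    rw [grad, spat_join] at h1
    exact ⟨h1, h2⟩

theorem dualValue_isTest_le (Du : VectorMeasure Ω E2) :
    dualValue f Ω (IsTest Ω) Du ≤ dualValue f Ω (IsTestGrad Ω) Du :=
  iSup₂_mono' fun ψ ⟨h1, h2, h3, φ, hφ, h⟩ => ⟨ψ, ⟨h1, h2, h3, φ, hφ.isTestGrad, h⟩, le_rfl⟩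

/-- Weak duality. -/
theorem dualValue_isTestGrad_le_F (hΩ : IsOpen Ω) {Du : VectorMeasure Ω E2}
    (hDu : IsDerivMeasure Ω u Du) :
    dualValue f Ω (IsTestGrad Ω) Du ≤ (F f Ω u : EReal) := by
  refine iSup₂_le fun ψ ⟨hψ, hψc, hψs, φ, hφ, hfeas⟩ => ?_
  have key : ∀ σ : VectorMeasure (Ω × S1) E3, DivFree σ → Projects u σ →
      ENNReal.ofReal (pair (fun x : Ω => ψ x) (perpMeasure Du)) ≤ energy f σ := by
    intro σ hdiv hproj
    obtain ⟨hm, ⟨C, hC⟩, h0⟩ := hφ.pair_grad_eq_zero hΩ hdiv hproj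
    obtain ⟨D, hD⟩ := hψc.exists_bound_of_continuous hψ
    have hψm : Measurable fun z : Ω × S1 => join (ψ z.1) 0 :=
      measurable_join (hψ.measurable.comp (by fun_prop)) measurable_const
    have hD' : ∀ z : Ω × S1, ‖join (ψ z.1) 0‖ ≤ D := fun z =>
      (norm_join_le _ _).trans (by rw [abs_zero, add_zero]; exact hD _)
    have hb : ∀ z : Ω × S1, ‖grad φ (z.1, z.2) + join (ψ z.1) 0‖ ≤ C + D := fun z =>
      (norm_add_le _ _).trans (add_le_add (hC z) (hD' z))
    have h1 := pair_grad_add_join σ hm hC hψm hD'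
    rw [h0, zero_add] at h1
    have hsum : Measurable fun z : Ω × S1 => grad φ (z.1, z.2) + join (ψ z.1) 0 := hm.add hψm
    rw [pair_perpMeasure_eq hΩ hDu hproj hψ hψc hψs, ← h1, pair_eq_integral_polar σ hsum hb]
    refine (ofReal_integral_le_lintegral
      (integrable_inner_of_bounded hsum hb (integrable_polar σ))).trans
      (lintegral_mono fun z => ?_)
    -- Feasibility provides a minorant at every point, hence the pointwise bound by `h` on the ray;
    -- off the ray `h` is infinite.
    have hA := add_conj_nonpos_iff.1 (hfeas z.1 z.1.2 z.2)
    rw [grad, ← join_add, inner_join, add_zero]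
    set P := polar σ z
    by_cases hray : ∃ r : ℝ, 0 ≤ r ∧ spat P = r • dir z.2
    · obtain ⟨r, hr, hP⟩ := hray
      have := affineMinorant_le_hfun hA hr hP
      rw [hP, real_inner_smul_right, real_inner_comm, mul_comm]
      exact this
    · have h0 : spat P ≠ 0 := fun h => hray ⟨0, le_rfl, by rw [h, zero_smul]⟩
      rw [hfun, if_neg h0, if_neg hray]
      exact le_top
  have h1 : ENNReal.ofReal (pair (fun x : Ω => ψ x) (perpMeasure Du)) ≤ F f Ω u :=
    le_iInf fun σ => le_iInf₂ fun hdiv hproj => key σ hdiv hproj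
  refine le_trans ?_ (EReal.coe_ennreal_le_coe_ennreal_iff.2 h1)
  rw [EReal.coe_ennreal_ofReal]
  exact_mod_cast le_max_left _ _

end WeakDuality

/-! ### Duality for linear programs over nonnegative measures -/

section AbstractDuality

open scoped CompactlySupported

/-- The Hahn-Banach theorem for a functional given on the range of a linear map. -/
theorem exists_linearMap_comp_eq_le_sublinear {V E : Type*} [AddCommGroup V] [Module ℝ V]
    [AddCommGroup E] [Module ℝ E] (T : V →ₗ[ℝ] E) (L : V →ₗ[ℝ] ℝ) (N : E → ℝ)
    (hN : ∀ c : ℝ, 0 < c → ∀ x, N (c • x) = c * N x) (hadd : ∀ x y, N (x + y) ≤ N x + N y)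
    (h : ∀ v, L v ≤ N (T v)) :
    ∃ Λ : E →ₗ[ℝ] ℝ, (∀ v, Λ (T v) = L v) ∧ ∀ x, Λ x ≤ N x := by
  have hN0 : N 0 = 0 := by
    have := hN 2 two_pos 0
    rw [smul_zero] at this
    linarith
  -- The bound applied to `v` and `-v` shows that `L` factors through the range of `T`.
  have hker : ∀ v, T v = 0 → L v = 0 := fun v hv => by
    have h1 := h v
    have h2 := h (-v)
    rw [map_neg, map_neg, hv, neg_zero, hN0] at h2
    rw [hv, hN0] at h1
    linarith
  obtain ⟨g, hg⟩ := LinearMap.exists_rightInverse_of_surjective T.rangeRestrict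
    T.range_rangeRestrict
  have hTg : ∀ x, T (g x) = x := fun x => congrArg Subtype.val (LinearMap.congr_fun hg x)
  obtain ⟨Λ, h1, h2⟩ := exists_extension_of_le_sublinear ⟨LinearMap.range T, L ∘ₗ g⟩ N hN hadd
    fun x => by
      have := h (g x)
      rwa [hTg] at this
  refine ⟨Λ, fun v => ?_, h2⟩
  have h3 := h1 ⟨T v, LinearMap.mem_range_self T v⟩
  refine h3.trans ?_
  change L (g ⟨T v, _⟩) = L v
  rw [← sub_eq_zero, ← map_sub]
  refine hker _ ?_
  rw [map_sub, hTg, sub_self]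

variable {X : Type*} [TopologicalSpace X]

/-- The least `t` with `g ≤ t c`. -/
def domination (c : X → ℝ≥0∞) (g : C_c(X, ℝ)) : ℝ :=
  sInf {t : ℝ | 0 < t ∧ ∀ x, ENNReal.ofReal (g x) ≤ ENNReal.ofReal t * c x}

variable {c : X → ℝ≥0∞} {δ : ℝ}

theorem domination_le {g : C_c(X, ℝ)} {t : ℝ} (ht : 0 < t)
    (h : ∀ x, ENNReal.ofReal (g x) ≤ ENNReal.ofReal t * c x) : domination c g ≤ t :=
  csInf_le ⟨0, fun _ hs => hs.1.le⟩ ⟨ht, h⟩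

/-- A bounded `g` lies below a multiple of a cost bounded away from zero. Without this the real
`sInf` in `domination` could take its default value `0`. -/
theorem domination_set_nonempty (hδ : 0 < δ) (hc : ∀ x, ENNReal.ofReal δ ≤ c x) (g : C_c(X, ℝ)) :
    {t : ℝ | 0 < t ∧ ∀ x, ENNReal.ofReal (g x) ≤ ENNReal.ofReal t * c x}.Nonempty := by
  obtain ⟨B, hB⟩ := g.hasCompactSupport.exists_bound_of_continuous g.continuous
  have hpos : 0 < (|B| + 1) / δ := by positivity
  refine ⟨(|B| + 1) / δ, hpos, fun x => ?_⟩
  calc ENNReal.ofReal (g x) ≤ ENNReal.ofReal ((|B| + 1) / δ * δ) := by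
        refine ENNReal.ofReal_le_ofReal ?_
        rw [div_mul_cancel₀ _ hδ.ne']
        have := (Real.norm_eq_abs (g x) ▸ hB x)
        linarith [le_abs_self (g x), le_abs_self B]
    _ = ENNReal.ofReal ((|B| + 1) / δ) * ENNReal.ofReal δ := ENNReal.ofReal_mul hpos.le
    _ ≤ _ := by gcongr; exact hc x

theorem domination_smul {s : ℝ} (hs : 0 < s) (g : C_c(X, ℝ)) :
    domination c (s • g) = s * domination c g := by
  rw [domination, domination, ← smul_eq_mul, ← Real.sInf_smul_of_nonneg hs.le]
  congr 1
  ext t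
  rw [mem_smul_set_iff_inv_smul_mem₀ hs.ne']
  simp only [mem_ofPred_eq, smul_eq_mul]
  refine and_congr (by rw [mul_pos_iff_of_pos_left (inv_pos.2 hs)]) (forall_congr' fun x => ?_)
  have h1 : ENNReal.ofReal ((s • g) x) = ENNReal.ofReal s * ENNReal.ofReal (g x) := by
    rw [CompactlySupportedContinuousMap.smul_apply, smul_eq_mul, ENNReal.ofReal_mul hs.le]
  have h2 : ENNReal.ofReal t = ENNReal.ofReal s * ENNReal.ofReal (s⁻¹ * t) := by
    rw [← ENNReal.ofReal_mul hs.le, mul_inv_cancel_left₀ hs.ne']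
  rw [h1, h2, mul_assoc, ENNReal.mul_le_mul_iff_right (by simp [hs]) ENNReal.ofReal_ne_top]

theorem domination_add_le (hδ : 0 < δ) (hc : ∀ x, ENNReal.ofReal δ ≤ c x) (g g' : C_c(X, ℝ)) :
    domination c (g + g') ≤ domination c g + domination c g' := by
  refine le_of_forall_pos_le_add fun ε hε => ?_
  obtain ⟨t, ⟨ht, h⟩, hlt⟩ := exists_lt_of_csInf_lt (domination_set_nonempty hδ hc g)
    (lt_add_of_pos_right _ (half_pos hε))
  obtain ⟨t', ⟨ht', h'⟩, hlt'⟩ := exists_lt_of_csInf_lt (domination_set_nonempty hδ hc g')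
    (lt_add_of_pos_right _ (half_pos hε))
  have h3 : domination c (g + g') ≤ t + t' := by
    refine domination_le (add_pos ht ht') fun x => ?_
    rw [CompactlySupportedContinuousMap.add_apply, ENNReal.ofReal_add ht.le ht'.le, add_mul]
    exact ENNReal.ofReal_add_le.trans (add_le_add (h x) (h' x))
  change t < domination c g + ε / 2 at hlt
  change t' < domination c g' + ε / 2 at hlt'
  linarith

theorem domination_nonpos {g : C_c(X, ℝ)} (hg : ∀ x, g x ≤ 0) : domination c g ≤ 0 :=
  le_of_forall_pos_le_add fun t ht => by
    rw [zero_add]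
    exact domination_le ht fun x => by simp [ENNReal.ofReal_of_nonpos (hg x)]

/-- Duality for a linear program over the nonnegative measures on a locally compact space: if
`L v ≤ M t` whenever `T v ≤ t c`, then there is a measure `μ` with `∫ c dμ ≤ M` which represents
`L`. -/
theorem exists_measure_of_forall_le [T2Space X] [LocallyCompactSpace X]
    [SecondCountableTopology X] [MeasurableSpace X] [BorelSpace X]
    (hδ : 0 < δ) (hc : ∀ x, ENNReal.ofReal δ ≤ c x) {l : ℕ → X → ℝ} (hl : ∀ n, Continuous (l n))
    (hcl : ∀ x, c x = ⨆ n, ENNReal.ofReal (l n x)) {V : Type*} [AddCommGroup V] [Module ℝ V]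
    (T : V →ₗ[ℝ] C_c(X, ℝ)) (L : V →ₗ[ℝ] ℝ) {M : ℝ} (hM : 0 < M)
    (h : ∀ v, ∀ t : ℝ, 0 < t → (∀ x, ENNReal.ofReal (T v x) ≤ ENNReal.ofReal t * c x) →
      L v ≤ M * t) :
    ∃ μ : Measure X, IsFiniteMeasure μ ∧ ∫⁻ x, c x ∂μ ≤ ENNReal.ofReal M ∧
      ∀ v, ∫ x, T v x ∂μ = L v := by
  obtain ⟨Λ, hΛ, hle⟩ := exists_linearMap_comp_eq_le_sublinear T L
    (fun g => M * domination c g)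
    (fun s hs g => by rw [domination_smul hs]; ring)
    (fun g g' => by
      rw [← mul_add]; exact mul_le_mul_of_nonneg_left (domination_add_le hδ hc g g') hM.le)
    (fun v => by
      rw [← div_le_iff₀' hM]
      exact le_csInf (domination_set_nonempty hδ hc _) fun t ht => by
        rw [div_le_iff₀' hM]; exact h v t ht.1 ht.2)
  -- Positivity comes from the one-sided gauge: nonpositive functions have `domination` at most `0`.
  have hpos : ∀ g : C_c(X, ℝ), 0 ≤ g → 0 ≤ Λ g := fun g hg => by
    have h1 := hle (-g)
    have h2 : domination c (-g) ≤ 0 := domination_nonpos fun x => by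
      have : 0 ≤ g x := hg x
      simpa using this
    rw [map_neg] at h1
    have := mul_nonpos_of_nonneg_of_nonpos hM.le h2
    linarith
  let Λ' : C_c(X, ℝ) →ₚ[ℝ] ℝ := PositiveLinearMap.mk₀ Λ hpos
  let μ := RealRMK.rieszMeasure Λ'
  have hμ : ∀ g : C_c(X, ℝ), ∫ x, g x ∂μ = Λ g := fun g => RealRMK.integral_rieszMeasure Λ' g
  have hcomp : ∀ K : Set X, IsCompact K → ∫⁻ x in K, c x ∂μ ≤ ENNReal.ofReal M := by
    intro K hK
    obtain ⟨η, hη1, -, hηc, hη⟩ :=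
      exists_continuous_one_zero_of_isCompact hK isClosed_empty (disjoint_empty K)
    -- Continuous nonnegative functions increasing to `c`. Multiplied by a cutoff, each has
    -- `domination` at most `1`, so its integral is at most `M`.
    let G : ℕ → X → ℝ := fun n x => (partialSups fun k => max (l k x) 0) n
    have hGs : ∀ n x, G (n + 1) x = max (G n x) (max (l (n + 1) x) 0) := fun n x =>
      partialSups_add_one _ n
    have hG0 : ∀ x, G 0 x = max (l 0 x) 0 := fun x => partialSups_zero _
    have hGc : ∀ n, Continuous (G n) := fun n => by
      induction n with
      | zero => exact ((hl 0).max continuous_const).congr fun x => (hG0 x).symm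
      | succ n ih =>
        exact (ih.max ((hl (n + 1)).max continuous_const)).congr fun x => (hGs n x).symm
    have hGn : ∀ n x, 0 ≤ G n x := fun n x =>
      (le_max_right (l n x) 0).trans (le_partialSups (fun k => max (l k x) 0) n)
    have hGle : ∀ n x, ENNReal.ofReal (G n x) ≤ c x := fun n x => by
      induction n with
      | zero =>
        rw [hG0, hcl, ENNReal.ofReal_max, ENNReal.ofReal_zero, max_eq_left zero_le]
        exact le_iSup (fun n => ENNReal.ofReal (l n x)) 0
      | succ n ih =>
        rw [hGs, ENNReal.ofReal_max, ENNReal.ofReal_max, ENNReal.ofReal_zero,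
          max_eq_left (a := ENNReal.ofReal (l (n + 1) x)) zero_le]
        refine max_le ih ?_
        rw [hcl]
        exact le_iSup (fun n => ENNReal.ofReal (l n x)) (n + 1)
    have hsup : ∀ x, c x ≤ ⨆ n, ENNReal.ofReal (G n x) := fun x => by
      rw [hcl]
      exact iSup_mono fun n => ENNReal.ofReal_le_ofReal
        ((le_max_left (l n x) 0).trans (le_partialSups (fun k => max (l k x) 0) n))
    refine (lintegral_mono hsup).trans ?_
    rw [lintegral_iSup (fun n => (hGc n).measurable.ennreal_ofReal)
      fun m n hmn x => ENNReal.ofReal_le_ofReal ((partialSups _).monotone hmn)]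
    refine iSup_le fun n => ?_
    let g : C_c(X, ℝ) := ⟨⟨fun x => η x * G n x, η.continuous.mul (hGc n)⟩, hηc.mul_right⟩
    have hg0 : ∀ x, 0 ≤ g x := fun x => mul_nonneg (hη x).1 (hGn n x)
    have hgle : Λ g ≤ M := by
      refine (hle g).trans ?_
      have : domination c g ≤ 1 := domination_le one_pos fun x => by
        rw [ENNReal.ofReal_one, one_mul]
        refine (ENNReal.ofReal_le_ofReal ?_).trans (hGle n x)
        exact mul_le_of_le_one_left (hGn n x) (hη x).2
      calc M * domination c g ≤ M * 1 := mul_le_mul_of_nonneg_left this hM.le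
        _ = M := mul_one M
    calc ∫⁻ x in K, ENNReal.ofReal (G n x) ∂μ = ∫⁻ x in K, ENNReal.ofReal (g x) ∂μ := by
          refine setLIntegral_congr_fun hK.measurableSet fun x hx => ?_
          change _ = ENNReal.ofReal (η x * G n x)
          rw [hη1 hx]
          simp
      _ ≤ ∫⁻ x, ENNReal.ofReal (g x) ∂μ := setLIntegral_le_lintegral _ _
      _ = ENNReal.ofReal (Λ g) := by
          rw [← hμ]
          exact (ofReal_integral_eq_lintegral_ofReal
            (g.continuous.integrable_of_hasCompactSupport g.hasCompactSupport)
            (ae_of_all _ hg0)).symm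
      _ ≤ ENNReal.ofReal M := ENNReal.ofReal_le_ofReal hgle
  have hint : ∫⁻ x, c x ∂μ ≤ ENNReal.ofReal M := by
    rw [← setLIntegral_univ, ← iUnion_compactCovering,
      setLIntegral_iUnion_of_directed _ (directed_of_isDirected_le
        fun _ _ hmn => compactCovering_subset X hmn)]
    exact iSup_le fun n => hcomp _ (isCompact_compactCovering X n)
  refine ⟨μ, ⟨?_⟩, hint, fun v => (hμ _).trans (hΛ v)⟩
  -- The lower bound on the cost converts finite cost into finite mass.
  have h1 : ENNReal.ofReal δ * μ univ ≤ ENNReal.ofReal M := by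
    rw [← lintegral_const]
    exact (lintegral_mono hc).trans hint
  by_contra! htop
  rw [top_le_iff.1 htop, ENNReal.mul_top (by simp [hδ])] at h1
  exact ENNReal.ofReal_ne_top (top_le_iff.1 h1)

end AbstractDuality

/-! ### Strong duality -/

section StrongDuality

open scoped CompactlySupported

variable {f : ℝ → ℝ≥0∞} {Ω : Set E2} {u : E2 → ℝ}

/-- The vector `((1 - |z|) dir θ, z)`; for `z ∈ [-1, 1]` these represent all directions `p` at which
the integrand may be finite. -/
def arcVec (θ : S1) (z : Icc (-1 : ℝ) 1) : E3 := join ((1 - |(z : ℝ)|) • dir θ) z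

theorem continuous_arcVec : Continuous fun q : S1 × Icc (-1 : ℝ) 1 => arcVec q.1 q.2 := by
  have hz : Continuous fun q : S1 × Icc (-1 : ℝ) 1 => (q.2 : ℝ) :=
    continuous_subtype_val.comp continuous_snd
  have hd : Continuous fun q : S1 × Icc (-1 : ℝ) 1 => (1 - |(q.2 : ℝ)|) • dir q.1 :=
    (continuous_const.sub hz.abs).smul (continuous_dir.comp continuous_fst)
  exact continuous_join.comp (hd.prodMk hz)

theorem continuous_arcVec_snd : Continuous fun x : (Ω × S1) × Icc (-1 : ℝ) 1 =>
    arcVec x.1.2 x.2 :=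
  continuous_arcVec.comp ((continuous_snd.comp continuous_fst).prodMk continuous_snd)

theorem abs_arc_le (z : Icc (-1 : ℝ) 1) : |(z : ℝ)| ≤ 1 := abs_le.2 z.2

theorem spat_arcVec (θ : S1) (z : Icc (-1 : ℝ) 1) :
    spat (arcVec θ z) = (1 - |(z : ℝ)|) • dir θ := spat_join _ _

theorem arcVec_two (θ : S1) (z : Icc (-1 : ℝ) 1) : arcVec θ z 2 = z := rfl

theorem arcVec_ne_zero (θ : S1) (z : Icc (-1 : ℝ) 1) : arcVec θ z ≠ 0 := fun h => by
  have h1 : (z : ℝ) = 0 := by rw [← arcVec_two θ z, h]; rfl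
  have h2 := spat_arcVec θ z
  rw [h, h1] at h2
  have h3 : dir θ = 0 := by
    have e : spat 0 = 0 := by ext i; fin_cases i <;> rfl
    rw [e] at h2; simpa using h2.symm
  simpa [h3] using norm_dir θ

theorem norm_arcVec_le (θ : S1) (z : Icc (-1 : ℝ) 1) : ‖arcVec θ z‖ ≤ 1 := by
  refine (norm_join_le _ _).trans (le_of_eq ?_)
  rw [norm_smul, norm_dir, mul_one, Real.norm_of_nonneg (sub_nonneg.2 (abs_arc_le z))]
  ring

/-- Since `(1 + |t|) / 2 ≤ √(1 + t ^ 2)`, both `γ/2 ± (γ/2) t` are minorants. With the sign of `z`,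
the value is `(γ/2) (1 - |z|) + (γ/2) |z| = γ/2`. -/
theorem le_hfun_arcVec {γ : ℝ} (hγ : 0 < γ)
    (hf : ∀ t : ℝ, ENNReal.ofReal (γ * √(1 + t ^ 2)) ≤ f t) (θ : S1) (z : Icc (-1 : ℝ) 1) :
    ENNReal.ofReal (γ / 2) ≤ hfun f θ (arcVec θ z) := by
  have hA : ∀ s : ℝ, |s| ≤ 1 → (γ / 2, s * (γ / 2)) ∈ affineMinorants f := fun s hs t => by
    refine (ENNReal.ofReal_le_ofReal ?_).trans (hf t)
    have h1 : s * t ≤ |t| := (le_abs_self _).trans (by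
      rw [abs_mul]; exact mul_le_of_le_one_left (abs_nonneg t) hs)
    have h2 : (1 + |t|) / 2 ≤ √(1 + t ^ 2) := by
      refine Real.le_sqrt_of_sq_le ?_
      rw [← sq_abs t]
      nlinarith [sq_nonneg (|t| - 1), abs_nonneg t]
    calc γ / 2 + s * (γ / 2) * t = γ * ((1 + s * t) / 2) := by ring
      _ ≤ γ * ((1 + |t|) / 2) := by gcongr
      _ ≤ γ * √(1 + t ^ 2) := by gcongr
  have hr := sub_nonneg.2 (abs_arc_le z)
  rcases le_total 0 (z : ℝ) with hz | hz
  · have := affineMinorant_le_hfun (hA 1 (by simp)) hr (spat_arcVec θ z)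
    rw [arcVec_two, abs_of_nonneg hz] at this
    refine le_trans (le_of_eq ?_) this
    congr 1
    ring
  · have := affineMinorant_le_hfun (hA (-1) (by simp)) hr (spat_arcVec θ z)
    rw [arcVec_two, abs_of_nonpos hz] at this
    refine le_trans (le_of_eq ?_) this
    congr 1
    ring

/-- The witness `z = τ / (1 + |τ|)` solves `z / (1 - |z|) = τ`, so the open arc sees every slope. -/
theorem hfun_arcVec_of_slope (θ : S1) (τ : ℝ) : ∃ z : Icc (-1 : ℝ) 1,
    0 < 1 - |(z : ℝ)| ∧ (z : ℝ) = (1 - |(z : ℝ)|) * τ ∧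
      hfun f θ (arcVec θ z) = ENNReal.ofReal (1 - |(z : ℝ)|) * f τ := by
  have hpos : 0 < 1 + |τ| := by positivity
  have habs : |τ / (1 + |τ|)| = |τ| / (1 + |τ|) := by rw [abs_div, abs_of_pos hpos]
  have h1 : 1 - |τ / (1 + |τ|)| = 1 / (1 + |τ|) := by rw [habs]; field_simp; ring
  have hlt : |τ / (1 + |τ|)| ≤ 1 := by
    rw [habs, div_le_one hpos]; linarith
  let z : Icc (-1 : ℝ) 1 := ⟨τ / (1 + |τ|), abs_le.1 hlt⟩
  have hz0 : 0 < 1 - |(z : ℝ)| := by rw [show (z : ℝ) = τ / (1 + |τ|) from rfl, h1]; positivity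
  have hzτ : (z : ℝ) = (1 - |(z : ℝ)|) * τ := by
    rw [show (z : ℝ) = τ / (1 + |τ|) from rfl, h1]; ring
  refine ⟨z, hz0, hzτ, ?_⟩
  have hn : ‖spat (arcVec θ z)‖ = 1 - |(z : ℝ)| := by
    rw [spat_arcVec, norm_smul, norm_dir, mul_one, Real.norm_of_nonneg hz0.le]
  have h0 : spat (arcVec θ z) ≠ 0 := norm_ne_zero_iff.1 (by rw [hn]; exact hz0.ne')
  rw [hfun, if_neg h0, if_pos ⟨_, hz0.le, spat_arcVec θ z⟩, hn, arcVec_two]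
  congr 2
  rw [div_eq_iff hz0.ne', mul_comm]
  exact hzτ

/-- The space `C_c^1(Ω × S¹)`. -/
def testSubmodule (Ω : Set E2) : Submodule ℝ (E2 × S1 → ℝ) where
  carrier := {φ | IsTest Ω φ}
  zero_mem' := IsTest.zero
  add_mem' := IsTest.add
  smul_mem' := fun c _ h => h.const_smul c

/-- The space `C_c^0(Ω; ℝ²)`. -/
def fieldSubmodule (Ω : Set E2) : Submodule ℝ (E2 → E2) where
  carrier := {ψ | Continuous ψ ∧ HasCompactSupport ψ ∧ tsupport ψ ⊆ Ω}
  zero_mem' := ⟨continuous_const, HasCompactSupport.zero, by simp [tsupport]⟩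
  add_mem' := fun {φ ψ} h h' =>
    ⟨h.1.add h'.1, h.2.1.add h'.2.1, (tsupport_add φ ψ).trans (union_subset h.2.2 h'.2.2)⟩
  smul_mem' := fun c ψ h => ⟨h.1.const_smul c, h.2.1.smul_left (f := fun _ => c),
    (tsupport_smul_subset_right (fun _ => c) ψ).trans h.2.2⟩

theorem IsTest.grad_add {φ ψ : E2 × S1 → ℝ} (h : IsTest Ω φ) (h' : IsTest Ω ψ) (z : E2 × S1) :
    grad (φ + ψ) z = grad φ z + grad ψ z := by
  obtain ⟨x, θ⟩ := z
  obtain ⟨t, rfl⟩ := QuotientAddGroup.mk_surjective θ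
  exact RotoTV.grad_add (h.differentiableAt _) (h'.differentiableAt _)

theorem IsTest.grad_const_smul {φ : E2 × S1 → ℝ} (h : IsTest Ω φ) (c : ℝ) (z : E2 × S1) :
    grad (c • φ) z = c • grad φ z := by
  obtain ⟨x, θ⟩ := z
  obtain ⟨t, rfl⟩ := QuotientAddGroup.mk_surjective θ
  exact RotoTV.grad_const_smul c (h.differentiableAt _)

/-- The field `(∇_x φ + ψ, ∂_θ φ)`. -/
def dualField (v : testSubmodule Ω × fieldSubmodule Ω) (z : E2 × S1) : E3 :=
  grad v.1 z + join ((v.2 : E2 → E2) z.1) 0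

theorem continuous_dualField (v : testSubmodule Ω × fieldSubmodule Ω) :
    Continuous (dualField v) :=
  v.1.2.continuous_grad.add
    (continuous_join.comp ((v.2.2.1.comp continuous_fst).prodMk continuous_const))

theorem hasCompactSupport_inner_dualField (v : testSubmodule Ω × fieldSubmodule Ω) :
    HasCompactSupport fun x : (Ω × S1) × Icc (-1 : ℝ) 1 =>
      ⟪dualField v (x.1.1, x.1.2), arcVec x.1.2 x.2⟫_ℝ := by
  let K : Set E2 := Prod.fst '' tsupport (v.1 : E2 × S1 → ℝ) ∪ tsupport (v.2 : E2 → E2)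
  have hK : IsCompact K := (v.1.2.2.1.image continuous_fst).union v.2.2.2.1
  have hKΩ : K ⊆ Ω := union_subset (by
    rintro _ ⟨z, hz, rfl⟩
    exact (v.1.2.2.2 hz).1) v.2.2.2.2
  have hK' : IsCompact (Subtype.val ⁻¹' K : Set Ω) :=
    Topology.IsInducing.subtypeVal.isCompact_preimage' hK (by simpa using hKΩ)
  refine HasCompactSupport.intro ((hK'.prod isCompact_univ).prod isCompact_univ) fun x hx => ?_
  have hxK : (x.1.1 : E2) ∉ K := fun h => hx ⟨⟨h, mem_univ _⟩, mem_univ _⟩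
  have h1 : grad (v.1 : E2 × S1 → ℝ) ((x.1.1 : E2), x.1.2) = 0 := by
    by_contra hn
    exact hxK (Or.inl ⟨_, support_grad_subset hn, rfl⟩)
  have h2 : (v.2 : E2 → E2) x.1.1 = 0 :=
    image_eq_zero_of_notMem_tsupport fun h => hxK (Or.inr h)
  have e : join (0 : E2) 0 = 0 := by ext i; fin_cases i <;> rfl
  rw [dualField, h1, h2, e, add_zero, inner_zero_left]

/-- The operator `(φ, ψ) ↦ (1 - |z|) dir θ · (∇_x φ + ψ) + z ∂_θ φ`. -/
def dualOp (Ω : Set E2) :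
    testSubmodule Ω × fieldSubmodule Ω →ₗ[ℝ] C_c((Ω × S1) × Icc (-1 : ℝ) 1, ℝ) where
  toFun v := ⟨⟨fun x => ⟪dualField v (x.1.1, x.1.2), arcVec x.1.2 x.2⟫_ℝ,
    ((continuous_dualField v).comp ((continuous_subtype_val.comp (continuous_fst.comp
      continuous_fst)).prodMk (continuous_snd.comp continuous_fst))).inner continuous_arcVec_snd⟩,
    hasCompactSupport_inner_dualField v⟩
  map_add' v w := by
    ext x
    change ⟪dualField (v + w) _, _⟫_ℝ = ⟪dualField v _, _⟫_ℝ + ⟪dualField w _, _⟫_ℝ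
    rw [← inner_add_left]
    congr 1
    have e : ∀ a b : E2, join (a + b) 0 = join a 0 + join b 0 := fun a b => by
      rw [← join_add, add_zero]
    change grad ((v.1 : E2 × S1 → ℝ) + w.1) _ + join ((v.2 : E2 → E2) _ + (w.2 : E2 → E2) _) 0 = _
    rw [v.1.2.grad_add w.1.2, e, dualField, dualField]
    abel
  map_smul' c v := by
    ext x
    change ⟪dualField (c • v) _, _⟫_ℝ = c * ⟪dualField v _, _⟫_ℝ
    rw [← real_inner_smul_left]
    congr 1
    have e : ∀ a : E2, join (c • a) 0 = c • join a 0 := fun a => by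
      rw [← join_smul, mul_zero]
    change grad (c • (v.1 : E2 × S1 → ℝ)) _ + join (c • (v.2 : E2 → E2) _) 0 = _
    rw [v.1.2.grad_const_smul, e, dualField, smul_add]

theorem dualOp_apply (v : testSubmodule Ω × fieldSubmodule Ω) (x : (Ω × S1) × Icc (-1 : ℝ) 1) :
    dualOp Ω v x = ⟪dualField v (x.1.1, x.1.2), arcVec x.1.2 x.2⟫_ℝ := rfl

/-- The functional `(φ, ψ) ↦ ∫ ψ · D`. -/
def fieldPairing (D : VectorMeasure Ω E2) : testSubmodule Ω × fieldSubmodule Ω →ₗ[ℝ] ℝ where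
  toFun v := pair (fun x : Ω => (v.2 : E2 → E2) x) D
  map_add' v w := by
    have := isFiniteMeasure_variation D
    have hi : ∀ ψ : fieldSubmodule Ω, Integrable (fun x : Ω => (ψ : E2 → E2) x) D.variation :=
      fun ψ => by
        obtain ⟨C, hC⟩ := ψ.2.2.1.exists_bound_of_continuous ψ.2.1
        exact Integrable.of_bound
          (ψ.2.1.comp continuous_subtype_val).aestronglyMeasurable C (ae_of_all _ fun x => hC x)
    exact VectorMeasure.integral_fun_add (hi v.2) (hi w.2)
  map_smul' c v := VectorMeasure.integral_fun_smul D (innerSL ℝ) c _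

/-- Testing at the arc point of slope `τ` and dividing by `1 - |z| > 0` leaves the minorant
inequality at `τ`. -/
theorem dualFeasible_of_dualOp_le (v : testSubmodule Ω × fieldSubmodule Ω)
    (h : ∀ x, ENNReal.ofReal (dualOp Ω v x) ≤ hfun f x.1.2 (arcVec x.1.2 x.2)) :
    DualFeasible f Ω (IsTest Ω) v.2 := by
  refine ⟨v.2.2.1, v.2.2.2.1, v.2.2.2.2, v.1, v.1.2, fun x hx θ => ?_⟩
  rw [add_conj_nonpos_iff]
  intro τ
  obtain ⟨z, hz0, hz, hfz⟩ := hfun_arcVec_of_slope (f := f) θ τ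
  have h1 := h ((⟨x, hx⟩, θ), z)
  rw [dualOp_apply, hfz] at h1
  have e : ⟪dualField v (x, θ), arcVec θ z⟫_ℝ = (1 - |(z : ℝ)|) *
      (⟪dir θ, gradX v.1 (x, θ) + (v.2 : E2 → E2) x⟫_ℝ + dTheta v.1 (x, θ) * τ) := by
    rw [dualField, grad, ← join_add, inner_join, spat_arcVec, arcVec_two, add_zero,
      real_inner_smul_right, real_inner_comm]
    linear_combination (dTheta v.1 (x, θ)) * hz
  rw [e, ENNReal.ofReal_mul hz0.le] at h1
  exact (ENNReal.mul_le_mul_iff_right (by simpa using hz0) ENNReal.ofReal_ne_top).1 h1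

theorem zero_le_dualValue (Du : VectorMeasure Ω E2) : 0 ≤ dualValue f Ω (IsTest Ω) Du := by
  have h0 : DualFeasible f Ω (IsTest Ω) 0 :=
    dualFeasible_of_dualOp_le (0 : testSubmodule Ω × fieldSubmodule Ω) fun x => by
      rw [map_zero]; simp
  refine le_trans (le_of_eq ?_) (le_iSup₂ (0 : E2 → E2) h0)
  have : pair (fun _ : Ω => (0 : E2)) (perpMeasure Du) = 0 := VectorMeasure.integral_zero
  rw [show (fun x : Ω => (0 : E2 → E2) x) = fun _ => 0 from rfl, this]
  rfl

/-- By homogeneity: `t⁻¹ • v` is feasible. This is the hypothesis of the abstract duality. -/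
theorem pair_le_of_dualOp_le {Du : VectorMeasure Ω E2} {M : ℝ}
    (h : dualValue f Ω (IsTest Ω) Du ≤ M) (v : testSubmodule Ω × fieldSubmodule Ω) {t : ℝ}
    (ht : 0 < t)
    (hv : ∀ x, ENNReal.ofReal (dualOp Ω v x) ≤
      ENNReal.ofReal t * hfun f x.1.2 (arcVec x.1.2 x.2)) :
    fieldPairing (perpMeasure Du) v ≤ M * t := by
  have hfeas : DualFeasible f Ω (IsTest Ω) (t⁻¹ • v).2 :=
    dualFeasible_of_dualOp_le _ fun x => by
      rw [map_smul, CompactlySupportedContinuousMap.smul_apply, smul_eq_mul,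
        ENNReal.ofReal_mul (inv_nonneg.2 ht.le)]
      calc _ ≤ ENNReal.ofReal t⁻¹ *
            (ENNReal.ofReal t * hfun f x.1.2 (arcVec x.1.2 x.2)) := by gcongr; exact hv x
        _ = _ := by
          rw [← mul_assoc, ← ENNReal.ofReal_mul (inv_nonneg.2 ht.le), inv_mul_cancel₀ ht.ne',
            ENNReal.ofReal_one, one_mul]
  have h1 : ((fieldPairing (perpMeasure Du) (t⁻¹ • v) : ℝ) : EReal) ≤ M :=
    (le_iSup₂ (f := fun ψ (_ : DualFeasible f Ω (IsTest Ω) ψ) =>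
      ((pair (fun x : Ω => ψ x) (perpMeasure Du) : ℝ) : EReal)) _ hfeas).trans h
  rwa [EReal.coe_le_coe_iff, map_smul, smul_eq_mul, inv_mul_le_iff₀ ht, mul_comm] at h1

theorem hfun_arcVec_eq_iSup (hc : ConvexOn ℝ≥0 univ f) (hl : LowerSemicontinuous f) :
    ∃ ξ : ℕ → (ℝ × ℝ) × ℝ, ∀ θ z, hfun f θ (arcVec θ z)
      = ⨆ n, ENNReal.ofReal ⟪dualVec θ (ξ n), arcVec θ z⟫_ℝ := by
  obtain ⟨ξ, hξ, hsup⟩ := exists_seq_hfun_le hc hl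
  refine ⟨ξ, fun θ z => (hsup _ _ (arcVec_ne_zero _ _)).antisymm (iSup_le fun n => ?_)⟩
  rw [inner_dualVec_ray _ _ (spat_arcVec θ z)]
  exact affineMinorant_le_hfun (hξ n) (sub_nonneg.2 (abs_arc_le z)) (spat_arcVec θ z)

theorem exists_measure_arc_of_dualValue_le (hΩ : IsOpen Ω) (hc : ConvexOn ℝ≥0 univ f)
    (hl : LowerSemicontinuous f) {γ : ℝ} (hγ : 0 < γ)
    (hf : ∀ t : ℝ, ENNReal.ofReal (γ * √(1 + t ^ 2)) ≤ f t) {Du : VectorMeasure Ω E2}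
    {M : ℝ} (hM : 0 < M) (h : dualValue f Ω (IsTest Ω) Du ≤ M) :
    ∃ μ : Measure ((Ω × S1) × Icc (-1 : ℝ) 1), IsFiniteMeasure μ ∧
      ∫⁻ x, hfun f x.1.2 (arcVec x.1.2 x.2) ∂μ ≤ ENNReal.ofReal M ∧
      ∀ v, ∫ x, dualOp Ω v x ∂μ = fieldPairing (perpMeasure Du) v := by
  have : LocallyCompactSpace Ω := hΩ.locallyCompactSpace
  obtain ⟨ξ, hξ⟩ := hfun_arcVec_eq_iSup hc hl
  have hcont : ∀ n, Continuous fun x : (Ω × S1) × Icc (-1 : ℝ) 1 =>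
      ⟪dualVec x.1.2 (ξ n), arcVec x.1.2 x.2⟫_ℝ := fun n =>
    Continuous.inner (continuous_dualVec.comp ((continuous_snd.comp continuous_fst).prodMk
      (continuous_const (y := ξ n)))) continuous_arcVec_snd
  have hlow : ∀ x : (Ω × S1) × Icc (-1 : ℝ) 1,
      ENNReal.ofReal (γ / 2) ≤ hfun f x.1.2 (arcVec x.1.2 x.2) := fun x =>
    le_hfun_arcVec hγ hf x.1.2 x.2
  have hsup : ∀ x : (Ω × S1) × Icc (-1 : ℝ) 1, hfun f x.1.2 (arcVec x.1.2 x.2)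
      = ⨆ n, ENNReal.ofReal ⟪dualVec x.1.2 (ξ n), arcVec x.1.2 x.2⟫_ℝ := fun x =>
    hξ x.1.2 x.2
  have hpair := fun v t ht hv => pair_le_of_dualOp_le (f := f) h v (t := t) ht hv
  exact exists_measure_of_forall_le (half_pos hγ) hlow hcont hsup (dualOp Ω)
    (fieldPairing (perpMeasure Du)) hM hpair

/-- The competitor is `arcVec μ` pushed to `Ω × S¹`. The pairs `(φ, 0)` show that it has no
divergence, the pairs `(0, φ^⊥)` that it projects to `Du^⊥`, and Jensen bounds its energy by the
cost of `μ`. -/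
theorem F_le_of_dualValue_le (hΩ : IsOpen Ω) (hc : ConvexOn ℝ≥0 univ f)
    (hl : LowerSemicontinuous f) {γ : ℝ} (hγ : 0 < γ)
    (hf : ∀ t : ℝ, ENNReal.ofReal (γ * √(1 + t ^ 2)) ≤ f t) {Du : VectorMeasure Ω E2}
    (hDu : IsDerivMeasure Ω u Du) {M : ℝ} (hM : 0 < M)
    (h : dualValue f Ω (IsTest Ω) Du ≤ M) : F f Ω u ≤ ENNReal.ofReal M := by
  obtain ⟨μ, hμ, hle, hrep⟩ := exists_measure_arc_of_dualValue_le hΩ hc hl hγ hf hM h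
  have hπ : Measurable (Prod.fst : (Ω × S1) × Icc (-1 : ℝ) 1 → Ω × S1) := measurable_fst
  have hv : Integrable (fun x : (Ω × S1) × Icc (-1 : ℝ) 1 => arcVec x.1.2 x.2) μ :=
    Integrable.of_bound continuous_arcVec_snd.aestronglyMeasurable 1
      (ae_of_all _ fun x => norm_arcVec_le _ _)
  have hray : ∀ x : (Ω × S1) × Icc (-1 : ℝ) 1,
      ∃ r : ℝ, 0 ≤ r ∧ spat (arcVec x.1.2 x.2) = r • dir x.1.2 := fun x =>
    ⟨_, sub_nonneg.2 (abs_arc_le x.2), spat_arcVec _ _⟩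
  refine (iInf₂_le
    (pushDensity μ Prod.fst fun x : (Ω × S1) × Icc (-1 : ℝ) 1 => arcVec x.1.2 x.2) ?_).trans
    ((iInf_le _ ?_).trans ((energy_pushDensity_le hc hl hπ hv hray).trans hle))
  · intro φ hφ
    obtain ⟨C, hC⟩ := hφ.exists_norm_grad_le
    refine (pair_pushDensity hπ hv hφ.measurable_grad fun z => hC _).trans ?_
    have h1 := hrep (⟨φ, hφ⟩, 0)
    have h2 : fieldPairing (perpMeasure Du) (⟨φ, hφ⟩, 0) = 0 :=
      VectorMeasure.integral_zero (X := Ω) (E := E2)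
    rw [h2] at h1
    rw [← h1]
    refine integral_congr_ae (ae_of_all _ fun x => ?_)
    have e : join (0 : E2) 0 = 0 := by ext i; fin_cases i <;> rfl
    change _ = ⟪grad φ _ + join (0 : E2) 0, _⟫_ℝ
    rw [e, add_zero]
  · intro φ hφ
    obtain ⟨C, hC⟩ := hφ.exists_norm_join_le (Ω := Ω)
    obtain ⟨C', hC'⟩ := hφ.exists_norm_le
    have hperp := pair_perp_perpMeasure Du (φ := fun x : Ω => φ x)
      (hφ.1.continuous.measurable.comp measurable_subtype_coe) fun x => hC' x
    rw [pair_pushDensity hπ hv hφ.measurable_join hC, ← hDu φ hφ, ← hperp]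
    have h1 := hrep (0, ⟨fun x => perp (φ x),
      hφ.perp.1.continuous, hφ.perp.2.1, hφ.perp.2.2⟩)
    refine Eq.trans ?_ h1
    refine integral_congr_ae (ae_of_all _ fun x => ?_)
    have e : grad (0 : E2 × S1 → ℝ) ((x.1.1 : E2), x.1.2) = 0 :=
      grad_eq_zero_of_eventuallyEq (Eventually.of_forall fun _ => rfl)
    change _ = ⟪grad (0 : E2 × S1 → ℝ) _ + join (perp (φ x.1.1)) 0, _⟫_ℝ
    rw [e, zero_add]

theorem F_le_dualValue (hΩ : IsOpen Ω) (hc : ConvexOn ℝ≥0 univ f)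
    (hl : LowerSemicontinuous f) {γ : ℝ} (hγ : 0 < γ)
    (hf : ∀ t : ℝ, ENNReal.ofReal (γ * √(1 + t ^ 2)) ≤ f t) {Du : VectorMeasure Ω E2}
    (hDu : IsDerivMeasure Ω u Du) : (F f Ω u : EReal) ≤ dualValue f Ω (IsTest Ω) Du := by
  refine le_of_forall_gt_imp_ge_of_dense fun b hb => ?_
  obtain ⟨M, hM, hMb⟩ := EReal.lt_iff_exists_real_btwn.1 hb
  -- The zero field is feasible, so any `M` above the dual value is positive, as the abstract
  -- duality requires.
  have hM0 : 0 < M := EReal.coe_lt_coe_iff.1 ((zero_le_dualValue Du).trans_lt hM)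
  refine le_trans (EReal.coe_ennreal_le_coe_ennreal_iff.2
    (F_le_of_dualValue_le hΩ hc hl hγ hf hDu hM0 hM.le)) ?_
  rw [EReal.coe_ennreal_ofReal, max_eq_left hM0.le]
  exact hMb.le

theorem F_eq_dualValue (hΩ : IsOpen Ω) (hc : ConvexOn ℝ≥0 univ f)
    (hl : LowerSemicontinuous f) {γ : ℝ} (hγ : 0 < γ)
    (hf : ∀ t : ℝ, ENNReal.ofReal (γ * √(1 + t ^ 2)) ≤ f t) {Du : VectorMeasure Ω E2}
    (hDu : IsDerivMeasure Ω u Du) :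
    (F f Ω u : EReal) = dualValue f Ω (IsTest Ω) Du ∧
      (F f Ω u : EReal) = dualValue f Ω (IsTestGrad Ω) Du := by
  have h1 := F_le_dualValue hΩ hc hl hγ hf hDu
  have h2 := dualValue_isTest_le (f := f) Du
  have h3 := dualValue_isTestGrad_le_F (f := f) hΩ hDu
  exact ⟨h1.antisymm (h2.trans h3), (h1.trans h2).antisymm h3⟩

end StrongDuality

/-! ### The Elastica integrand -/

section Elastica

variable {α : ℝ}

theorem convexOn_elastica (α : ℝ) : ConvexOn ℝ≥0 univ (elastica α) := by
  refine ⟨convex_univ, fun x _ y _ a b _ _ hab => ?_⟩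
  have hab' : (a : ℝ) + b = 1 := by exact_mod_cast hab
  have e : ∀ (a : ℝ≥0) (x : ℝ), a • elastica α x = ENNReal.ofReal (a * (1 + α ^ 2 * x ^ 2)) :=
    fun a x => by
      rw [ENNReal.ofReal_mul (NNReal.coe_nonneg a), ENNReal.smul_def, smul_eq_mul,
        ENNReal.ofReal_coe_nnreal]
      rfl
  rw [e, e, ← ENNReal.ofReal_add (by positivity) (by positivity)]
  refine ENNReal.ofReal_le_ofReal ?_
  simp only [NNReal.smul_def, smul_eq_mul]
  have hb : (b : ℝ) = 1 - a := by linarith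
  -- This is exactly the convexity defect of the quadratic.
  have h1 : 0 ≤ (a : ℝ) * b * (α ^ 2 * (x - y) ^ 2) := by positivity
  rw [hb] at h1 ⊢
  nlinarith [h1]

theorem lowerSemicontinuous_elastica (α : ℝ) : LowerSemicontinuous (elastica α) :=
  (ENNReal.continuous_ofReal.comp (by fun_prop)).lowerSemicontinuous

theorem exists_le_elastica (hα : 0 < α) :
    ∃ γ : ℝ, 0 < γ ∧ ∀ t : ℝ, ENNReal.ofReal (γ * √(1 + t ^ 2)) ≤ elastica α t := by
  refine ⟨min 1 (α ^ 2), lt_min one_pos (by positivity), fun t => ENNReal.ofReal_le_ofReal ?_⟩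
  have h1 : √(1 + t ^ 2) ≤ 1 + t ^ 2 := by
    rw [Real.sqrt_le_left (by positivity)]
    nlinarith [sq_nonneg t, sq_nonneg (t ^ 2)]
  calc min 1 (α ^ 2) * √(1 + t ^ 2) ≤ min 1 (α ^ 2) * (1 + t ^ 2) := by gcongr
    _ = min 1 (α ^ 2) * 1 + min 1 (α ^ 2) * t ^ 2 := by ring
    _ ≤ 1 * 1 + α ^ 2 * t ^ 2 := by
      gcongr
      · exact min_le_left _ _
      · exact min_le_right _ _
    _ = 1 + α ^ 2 * t ^ 2 := by ring

theorem recession_elastica (hα : 0 < α) {t : ℝ} (ht : t ≠ 0) : recession (elastica α) t = ⊤ := by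
  have h1 : Tendsto (fun s : ℝ => ENNReal.ofReal (s * (α ^ 2 * t ^ 2))) atTop (𝓝 ⊤) :=
    ENNReal.tendsto_ofReal_atTop.comp (tendsto_id.atTop_mul_const (by positivity))
  rw [← top_le_iff, ← h1.limsup_eq]
  refine limsup_le_limsup ?_
  filter_upwards [eventually_gt_atTop 0] with s hs
  rw [elastica, ← ENNReal.ofReal_div_of_pos hs]
  refine ENNReal.ofReal_le_ofReal ?_
  rw [le_div_iff₀ hs]
  nlinarith

end Elastica

end RotoTV

end

theorem mainTheorem4 (Ω : Set RotoTV.E2) (hΩ : IsOpen Ω) (hb : Bornology.IsBounded Ω)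
    (u : RotoTV.E2 → ℝ) (hu : IntegrableOn u Ω volume) :
    (∀ α : ℝ, 0 < α →
      RotoTV.F (RotoTV.elastica α) Ω u = RotoTV.Rel α Ω u ∧
      ∀ Du : VectorMeasure Ω RotoTV.E2, RotoTV.IsDerivMeasure Ω u Du →
        (RotoTV.F (RotoTV.elastica α) Ω u : EReal) =
          RotoTV.dualValue (RotoTV.elastica α) Ω (RotoTV.IsTest Ω) Du ∧
        (RotoTV.Rel α Ω u : EReal) =
          RotoTV.dualValue (RotoTV.elastica α) Ω (RotoTV.IsTest Ω) Du) ∧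
    (∀ f : ℝ → ℝ≥0∞, ConvexOn ℝ≥0 univ f → LowerSemicontinuous f →
      (∃ γ : ℝ, 0 < γ ∧ ∀ t : ℝ, ENNReal.ofReal (γ * √(1 + t ^ 2)) ≤ f t) →
      ((∀ t : ℝ, t ≠ 0 → RotoTV.recession f t = ⊤) →
        RotoTV.F f Ω u = RotoTV.liftedRelaxation f Ω u) ∧
      ∀ Du : VectorMeasure Ω RotoTV.E2, RotoTV.IsDerivMeasure Ω u Du →
        (RotoTV.F f Ω u : EReal) = RotoTV.dualValue f Ω (RotoTV.IsTest Ω) Du ∧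
        (RotoTV.F f Ω u : EReal) = RotoTV.dualValue f Ω (RotoTV.IsTestGrad Ω) Du) := by
  refine ⟨fun α hα => ?_, fun f hc hl ⟨γ, hγ, hf⟩ =>
    ⟨fun hrec => RotoTV.F_eq_liftedRelaxation hc hl hrec,
      fun Du hDu => RotoTV.F_eq_dualValue hΩ hc hl hγ hf hDu⟩⟩
  obtain ⟨γ, hγ, hf⟩ := RotoTV.exists_le_elastica hα
  have hc := RotoTV.convexOn_elastica α
  have hl := RotoTV.lowerSemicontinuous_elastica α
  have h : RotoTV.F (RotoTV.elastica α) Ω u = RotoTV.Rel α Ω u :=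
    RotoTV.F_eq_liftedRelaxation hc hl fun t ht => RotoTV.recession_elastica hα ht
  refine ⟨h, fun Du hDu => ?_⟩
  rw [← h, and_self]
  exact (RotoTV.F_eq_dualValue hΩ hc hl hγ hf hDu).1
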